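/- **Definitions.** An *almost group* is a set $G$ with an associative product, a bijection $i:G\to G$, $g\mapsto g^i$, and a subset $J\subset G$ closed under the product and under $i$, such that for all $g,h\in G$, $j\in J$: (a) $(gh)^i=h^ig^i$; (b) $jg=gj$; (c) $gg^i=g^ig\in J$; (d) $(g^i)^i=g$. Let $n\ge 2$. A *loop* is a meromorphic (i.e. rational) function $\phi:\mathbb C_\infty\to M_n(\mathbb C)$ that is unitary on the real axis, with $\phi(\infty)=1$. Let $G$ (resp. $M$) be the set of loops without poles in the upper (resp. lower) half plane, with pointwise multiplication, and let $J_G\subset G$, $J_M\subset M$ be the scalar ones (a scalar function times the identity). For $\alpha\in\mathbb C\setminus\mathbb R$ put $\theta_\alpha(\lambda)=\frac{\lambda-\bar\alpha}{\lambda-\alpha}$. For a self-adjoint projection $P\ne 0,1$ let $\Phi_{\alpha,P}=P^\perp+\theta_\alpha P$ be the *basic loop*, and $\Phi_{\alpha,P}^i=\theta_\alpha P^\perp+P$. For a loop $\phi$ written as a product $\Phi_1\cdots\Phi_N$ of the minimum number of basic loops put $\phi^i=\Phi_N^i\cdots\Phi_1^i$. For $s\in M$, $u\in G$ let $s\triangleright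 u\in G$ and $s\triangleleft u\in M$ be such that $su=(s\triangleright u)(s\triangleleft u)$, chosen so that the total number of basic loops needed to write $s\triangleright u$ and $s\triangleleft u$ is minimal. Call $(s,u)\in M\times G$ *admissible* if no pole of $s$ is the complex conjugate of a pole of $u$. Call a loop *simple* if it is a product of basic loops whose pole positions are pairwise distinct and pairwise not conjugate. **Proposition.** Let $n\ge2$. 1. $G$ (resp. $M$) is exactly the set of products of basic loops with poles in the lower (resp. upper) half plane. The operation $i$ is well defined on $G$ and on $M$, and $s\triangleright u$, $s\triangleleft u$ exist and are unique for every admissible pair $(s,u)$. 2. For all $k,m$, consider the space of pairs (a $k$-tuple of parameters $(\alpha,P)$ with $\operatorname{Im}\alpha>0$, an $m$-tuple of parameters $(\beta,Q)$ with $\operatorname{Im}\beta<0$). The parameters with all pole positions distinct and no two of them conjugate form a dense open subset, and for these the two products of basic loops are simple and form an admissible pair. 3. $(G,J_G)$ and $(M,J_M)$, with the operation $i$, are almost groups in the following sense: $G$ and $M$ are closed under products and $i$, their subsets $J_G$ and $J_M$ are closed under products and $i$, (b) and (c) hold everywhere, (a) holds whenever $g$ and $h$ have no common pole, and $i$ restricts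 to a bijection of the set of simple loops, on which (d) holds. If $n=2$, then $(G,J_G)$ and $(M,J_M)$ are almost groups without any restriction. 4. They form a matched pair with the densely defined actions $\triangleright,\triangleleft$: for $s,t\in M$, $u,v\in G$, whenever the pairs formed from the given elements of $M$ and $G$ that occur in an identity are admissible, all the actions in that identity are of admissible pairs, and $$s\triangleleft uv=(s\triangleleft u)\triangleleft v,\qquad st\triangleleft u=(s\triangleleft(t\triangleright u))(t\triangleleft u),$$ $$st\triangleright u=s\triangleright(t\triangleright u),\qquad s\triangleright uv=(s\triangleright u)((s\triangleleft u)\triangleright v),$$ $$(s\triangleleft u)^i\triangleright(s\triangleright u)^i=u^i,\qquad (s\triangleleft u)^i\triangleleft(s\triangleright u)^i=s^i,$$ and $j\triangleright u=u$, $j\triangleleft u=j$ for $j\in J_M$, $s\triangleright j=j$, $s\triangleleft j=s$ for $j\in J_G$. -/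

import Mathlib

open Filter Topology

noncomputable section

/-! ### Almost groups and matched pairs -/

/-- `(G, J)` with the operation `i` is an almost group, where the `i`-involution laws are only
required on the set `S`, and `(g h)^i = h^i g^i` only for pairs related by `R`.
For `S = univ` and `R` always true this is the notion of an almost group. -/
structure IsAlmostGroupOn {X : Type*} [Semigroup X] (G J : Set X) (i : X → X)
    (S : Set X) (R : X → X → Prop) : Prop where
  mul_mem : ∀ g ∈ G, ∀ h ∈ G, g * h ∈ G
  i_mem : ∀ g ∈ G, i g ∈ G
  i_bijOn : Set.BijOn i (G ∩ S) (G ∩ S)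
  J_subset : J ⊆ G
  J_mul_mem : ∀ j ∈ J, ∀ k ∈ J, j * k ∈ J
  J_i_mem : ∀ j ∈ J, i j ∈ J
  i_mul : ∀ g ∈ G, ∀ h ∈ G, R g h → i (g * h) = i h * i g
  J_central : ∀ g ∈ G, ∀ j ∈ J, j * g = g * j
  mul_i_comm : ∀ g ∈ G, g * i g = i g * g
  mul_i_mem : ∀ g ∈ G, g * i g ∈ J
  i_i : ∀ g ∈ G ∩ S, i (i g) = g

/-- An almost group: all laws hold everywhere. -/
def IsAlmostGroup {X : Type*} [Semigroup X] (G J : Set X) (i : X → X) : Prop :=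
  IsAlmostGroupOn G J i Set.univ (fun _ _ => True)

/-- `(G, JG)` and `(M, JM)` form a matched pair with actions `l s u = s ▷ u` and `r s u = s ◁ u`
defined for the pairs `(s, u) ∈ M × G` with `D s u`. Every law is required whenever the actions of
the given elements on one another are defined; the fields `dom_*` say that then all the other
actions that occur in the laws are defined as well. -/
structure IsMatchedPairOn {X : Type*} [Semigroup X] (G JG M JM : Set X) (i : X → X)
    (l r : X → X → X) (D : X → X → Prop) : Prop where
  l_mem : ∀ s ∈ M, ∀ u ∈ G, D s u → l s u ∈ G
  r_mem : ∀ s ∈ M, ∀ u ∈ G, D s u → r s u ∈ M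
  dom_mul_left : ∀ s ∈ M, ∀ t ∈ M, ∀ u ∈ G, D s u → D t u → D (s * t) u
  dom_mul_right : ∀ s ∈ M, ∀ u ∈ G, ∀ v ∈ G, D s u → D s v → D s (u * v)
  dom_l : ∀ s ∈ M, ∀ t ∈ M, ∀ u ∈ G, D s u → D t u → D s (l t u)
  dom_r : ∀ s ∈ M, ∀ u ∈ G, ∀ v ∈ G, D s u → D s v → D (r s u) v
  dom_i : ∀ s ∈ M, ∀ u ∈ G, D s u → D (i (r s u)) (i (l s u))
  r_mul : ∀ s ∈ M, ∀ u ∈ G, ∀ v ∈ G, D s u → D s v → r s (u * v) = r (r s u) v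
  mul_r : ∀ s ∈ M, ∀ t ∈ M, ∀ u ∈ G, D s u → D t u → r (s * t) u = r s (l t u) * r t u
  mul_l : ∀ s ∈ M, ∀ t ∈ M, ∀ u ∈ G, D s u → D t u → l (s * t) u = l s (l t u)
  l_mul : ∀ s ∈ M, ∀ u ∈ G, ∀ v ∈ G, D s u → D s v → l s (u * v) = l s u * l (r s u) v
  l_i : ∀ s ∈ M, ∀ u ∈ G, D s u → l (i (r s u)) (i (l s u)) = i u
  r_i : ∀ s ∈ M, ∀ u ∈ G, D s u → r (i (r s u)) (i (l s u)) = i s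
  J_l : ∀ j ∈ JM, ∀ u ∈ G, D j u → l j u = u
  J_r : ∀ j ∈ JM, ∀ u ∈ G, D j u → r j u = j
  l_J : ∀ s ∈ M, ∀ j ∈ JG, D s j → l s j = j
  r_J : ∀ s ∈ M, ∀ j ∈ JG, D s j → r s j = s

/-! ### Meromorphic loops -/

/-- Matrix valued meromorphic functions on the Riemann sphere, that is, matrices over the field
`ℂ(λ)` of meromorphic functions on the sphere. -/
abbrev MeroMatrix (n : ℕ) : Type := Matrix (Fin n) (Fin n) (RatFunc ℂ)

namespace MeroMatrix

variable {n : ℕ}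

/-- The value at a point `z` that is not a pole. -/
def value (φ : MeroMatrix n) (z : ℂ) : Matrix (Fin n) (Fin n) ℂ :=
  φ.map (fun f => f.eval (RingHom.id ℂ) z)

/-- `z` is a pole of some entry. -/
def HasPole (φ : MeroMatrix n) (z : ℂ) : Prop :=
  ∃ a b, (φ a b).denom.eval z = 0

/-- Unitary on the real axis and equal to the identity at infinity. -/
def IsUnitaryLoop (φ : MeroMatrix n) : Prop :=
  (∀ x : ℝ, ¬ φ.HasPole (x : ℂ) ∧ φ.value (x : ℂ) ∈ Matrix.unitaryGroup (Fin n) ℂ) ∧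
    Tendsto φ.value (cocompact ℂ) (𝓝 1)

end MeroMatrix

/-- Normalised unitary loops without poles in the upper half plane. -/
def loopG (n : ℕ) : Set (MeroMatrix n) :=
  {φ | φ.IsUnitaryLoop ∧ ∀ z : ℂ, 0 < z.im → ¬ φ.HasPole z}

/-- Normalised unitary loops without poles in the lower half plane. -/
def loopM (n : ℕ) : Set (MeroMatrix n) :=
  {φ | φ.IsUnitaryLoop ∧ ∀ z : ℂ, z.im < 0 → ¬ φ.HasPole z}

/-- The scalar loops in `loopG n`. -/
def loopJG (n : ℕ) : Set (MeroMatrix n) :=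
  {φ | φ ∈ loopG n ∧ ∃ f : RatFunc ℂ, φ = f • (1 : MeroMatrix n)}

/-- The scalar loops in `loopM n`. -/
def loopJM (n : ℕ) : Set (MeroMatrix n) :=
  {φ | φ ∈ loopM n ∧ ∃ f : RatFunc ℂ, φ = f • (1 : MeroMatrix n)}

/-! ### Basic loops -/

/-- A pole position off the real axis and a self-adjoint projection other than `0` and `1`. -/
abbrev BasicParam (n : ℕ) : Type :=
  {p : ℂ × Matrix (Fin n) (Fin n) ℂ //
    p.1.im ≠ 0 ∧ IsStarProjection p.2 ∧ p.2 ≠ 0 ∧ p.2 ≠ 1}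

namespace BasicParam

variable {n : ℕ}

/-- The pole position. -/
def pole (p : BasicParam n) : ℂ := p.1.1

/-- The projection. -/
def proj (p : BasicParam n) : Matrix (Fin n) (Fin n) ℂ := p.1.2

/-- `θ_α(λ) = (λ - conj α) / (λ - α)`. -/
def theta (α : ℂ) : RatFunc ℂ :=
  (RatFunc.X - RatFunc.C (starRingEnd ℂ α)) / (RatFunc.X - RatFunc.C α)

/-- The basic loop `P^⊥ + θ_α P`. -/
def loop (p : BasicParam n) : MeroMatrix n :=
  (1 - p.proj).map RatFunc.C + theta p.pole • p.proj.map RatFunc.C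

/-- The image `θ_α P^⊥ + P` of the basic loop under the `i` operation. -/
def loopI (p : BasicParam n) : MeroMatrix n :=
  theta p.pole • (1 - p.proj).map RatFunc.C + p.proj.map RatFunc.C

/-- A product of basic loops. -/
def word (w : List (BasicParam n)) : MeroMatrix n := (w.map loop).prod

/-- The product of the `i`-images of the factors in the reversed order. -/
def wordI (w : List (BasicParam n)) : MeroMatrix n := (w.reverse.map loopI).prod

end BasicParam

/-- `w` is a factorisation of `φ` into the minimum number of basic loops. -/
def IsMinWord {n : ℕ} (φ : MeroMatrix n) (w : List (BasicParam n)) : Prop :=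
  BasicParam.word w = φ ∧ ∀ w', BasicParam.word w' = φ → w.length ≤ w'.length

/-- `ψ` is obtained from `φ` by the `i` operation on a minimal factorisation. -/
def IsI {n : ℕ} (φ ψ : MeroMatrix n) : Prop :=
  ∃ w, IsMinWord φ w ∧ ψ = BasicParam.wordI w

open Classical in
/-- The `i` operation. -/
def iOp {n : ℕ} (φ : MeroMatrix n) : MeroMatrix n :=
  if h : ∃ ψ, IsI φ ψ then h.choose else φ

/-- `s u = u' s'` with `u' ∈ G`, `s' ∈ M`, where `u'` and `s'` are written with `N` basic loops in
total. -/
def IsRefactor {n : ℕ} (s u : MeroMatrix n) (p : MeroMatrix n × MeroMatrix n) (N : ℕ) : Prop :=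
  p.1 ∈ loopG n ∧ p.2 ∈ loopM n ∧ s * u = p.1 * p.2 ∧
    ∃ w₁ w₂, BasicParam.word w₁ = p.1 ∧ BasicParam.word w₂ = p.2 ∧ w₁.length + w₂.length = N

/-- A refactorisation of `s u` with the minimum number of basic loops. -/
def IsMinRefactor {n : ℕ} (s u : MeroMatrix n) (p : MeroMatrix n × MeroMatrix n) : Prop :=
  ∃ N, IsRefactor s u p N ∧ ∀ q N', IsRefactor s u q N' → N ≤ N'

open Classical in
/-- The pair `(s ▷ u, s ◁ u)`. -/
def refactor {n : ℕ} (s u : MeroMatrix n) : MeroMatrix n × MeroMatrix n :=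
  if h : ∃ p, IsMinRefactor s u p then h.choose else (u, s)

/-- `s ▷ u`. -/
def lAct {n : ℕ} (s u : MeroMatrix n) : MeroMatrix n := (refactor s u).1

/-- `s ◁ u`. -/
def rAct {n : ℕ} (s u : MeroMatrix n) : MeroMatrix n := (refactor s u).2

/-! ### The generic loops -/

/-- No pole of `s` is the complex conjugate of a pole of `u`. -/
def NoConjPoles {n : ℕ} (s u : MeroMatrix n) : Prop :=
  ∀ z : ℂ, s.HasPole z → ¬ u.HasPole (starRingEnd ℂ z)

/-- No pole of `g` is a pole of `h`. -/
def NoCommonPoles {n : ℕ} (g h : MeroMatrix n) : Prop :=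
  ∀ z : ℂ, g.HasPole z → ¬ h.HasPole z

/-- The loops without multiple poles and without poles at conjugate positions: the products of
basic loops whose pole positions are distinct and not conjugate to each other. -/
def simpleLoops (n : ℕ) : Set (MeroMatrix n) :=
  {φ | ∃ w : List (BasicParam n),
    w.Pairwise (fun p q => p.pole ≠ q.pole ∧ p.pole ≠ starRingEnd ℂ q.pole) ∧
      φ = BasicParam.word w}

/-- Parameters of basic loops with pole in the upper half plane. -/
abbrev UpperParam (n : ℕ) : Type := {p : BasicParam n // 0 < p.pole.im}

/-- Parameters of basic loops with pole in the lower half plane. -/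
abbrev LowerParam (n : ℕ) : Type := {p : BasicParam n // p.pole.im < 0}

/-- The product of `k` basic loops with poles in the upper half plane. -/
def upperLoop {n k : ℕ} (x : Fin k → UpperParam n) : MeroMatrix n :=
  BasicParam.word (List.ofFn fun a => (x a).1)

/-- The product of `k` basic loops with poles in the lower half plane. -/
def lowerLoop {n k : ℕ} (y : Fin k → LowerParam n) : MeroMatrix n :=
  BasicParam.word (List.ofFn fun a => (y a).1)

/-- The parameters of pairs of products of basic loops for which the pole positions are all
distinct and no two of them are conjugate. -/
def genericParams (n k m : ℕ) : Set ((Fin k → UpperParam n) × (Fin m → LowerParam n)) :=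
  {q | (∀ a b, a ≠ b → (q.1 a).1.pole ≠ (q.1 b).1.pole) ∧
    (∀ a b, a ≠ b → (q.2 a).1.pole ≠ (q.2 b).1.pole) ∧
    ∀ a b, (q.1 a).1.pole ≠ starRingEnd ℂ (q.2 b).1.pole}

end

/-! ### Regular rational functions -/

namespace RatFunc

/-! With coefficient conjugation as the star on `RatFunc ℂ`, a unitary loop satisfies `φᴴ * φ = 1`,
so its inverse is `φᴴ`. The poles of `φᴴ` are the conjugates of those of `φ`: wherever `φ` is
regular at both `z` and `star z`, it is invertible over the regular functions at `z`. A loop without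
poles is trivial by Liouville.

The central quantity is `mult φ α`, the least `N` for which `(X - α) ^ N • φ` and `(X - α) ^ ((n -
1) * N) * det φ` are regular at `α`. A basic loop at `α` has a simple pole and determinant `θ ^
rank` with `1 ≤ rank ≤ n - 1`, so a factorisation contains at least `mult φ α` letters at `α`.
Conversely, if `φ` is regular at `star α`, the projection onto the range of its leading coefficient
splits off one order of the pole (`IsLoop.exists_split`). This may produce the projections `0` and
`1`. The former are dropped; the latter are scalars `θ` and are absorbed by `θ (P^⊥ + θ P) =
projLoop (P + E) * projLoop (1 - E)`, for which the determinant bound leaves exactly enough room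
(`IsLoop.exists_extract`). Hence a loop without conjugate poles has a word with `mult φ α` letters
at every `α`, and its minimal words are precisely those (`IsGenericLoop.exists_words`,
`IsGenericLoop.poleCount_eq_mult`).

The involution is then independent of the word: on words it is `φᴴ` times the product of the `θ` of
the letters (`wordI_eq`), and a minimal word has its poles prescribed by `mult`. The almost group
laws follow from this formula, law (a) under additivity of `mult` and law (d) for words with
distinct nonconjugate poles. For `n = 2` the scalar is `det φ`, so the involution is the adjugate
and no restriction remains.

For an admissible pair, `s * u` has no conjugate poles. Minimality forces the factors of a
refactorisation to have none either, and among such factorisations there is only one, again by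
Liouville (`eq_of_mul_eq_mul`). So the actions are characterised by `IsAction`, and each matched
pair law amounts to exhibiting a factorisation. -/

open Polynomial in
-- Frees the test of regularity from the reduced fraction: any representation with nonvanishing
-- denominator will do, because the reduced denominator divides it.
theorem denom_eval_ne_zero_iff {f : RatFunc ℂ} {z : ℂ} :
    f.denom.eval z ≠ 0 ↔
      ∃ p q : ℂ[X], q.eval z ≠ 0 ∧ f = algebraMap ℂ[X] (RatFunc ℂ) p / algebraMap _ _ q := by
  constructor
  · intro h
    exact ⟨f.num, f.denom, h, (num_div_denom f).symm⟩
  · rintro ⟨p, q, hq, rfl⟩ h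
    obtain ⟨r, hr⟩ := denom_div_dvd p q
    apply hq
    rw [hr, Polynomial.eval_mul, h, zero_mul]

/-- The ring of rational functions without a pole at `z`. -/
def regAt (z : ℂ) : Subring (RatFunc ℂ) where
  carrier := {f | f.denom.eval z ≠ 0}
  mul_mem' {f g} hf hg h := by
    obtain ⟨r, hr⟩ := denom_mul_dvd f g
    have : (f.denom * g.denom).eval z ≠ 0 := by
      rw [Polynomial.eval_mul]; exact mul_ne_zero hf hg
    apply this
    rw [hr, Polynomial.eval_mul, h, zero_mul]
  one_mem' := by simp
  add_mem' {f g} hf hg h := by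
    obtain ⟨r, hr⟩ := denom_add_dvd f g
    have : (f.denom * g.denom).eval z ≠ 0 := by
      rw [Polynomial.eval_mul]; exact mul_ne_zero hf hg
    apply this
    rw [hr, Polynomial.eval_mul, h, zero_mul]
  zero_mem' := by simp
  neg_mem' {f} hf := by
    obtain ⟨p, q, hq, h⟩ := denom_eval_ne_zero_iff.1 hf
    exact denom_eval_ne_zero_iff.2 ⟨-p, q, hq, by rw [h, map_neg]; exact (neg_div _ _).symm⟩

variable {z : ℂ} {f g : RatFunc ℂ}

theorem mem_regAt : f ∈ regAt z ↔ f.denom.eval z ≠ 0 := Iff.rfl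

open Polynomial in
theorem algebraMap_mem_regAt (p : ℂ[X]) (z : ℂ) : algebraMap ℂ[X] (RatFunc ℂ) p ∈ regAt z := by
  simp [mem_regAt]

theorem C_mem_regAt (c z : ℂ) : C c ∈ regAt z := by simp [mem_regAt]

theorem X_sub_C_eq (c : ℂ) :
    X - C c = algebraMap (Polynomial ℂ) (RatFunc ℂ) (Polynomial.X - Polynomial.C c) := by
  simp

theorem X_sub_C_mem_regAt (c z : ℂ) : X - C c ∈ regAt z := by
  rw [X_sub_C_eq]; exact algebraMap_mem_regAt _ _

theorem X_sub_C_ne_zero (c : ℂ) : (X - C c : RatFunc ℂ) ≠ 0 := by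
  rw [X_sub_C_eq]; exact algebraMap_ne_zero (Polynomial.X_sub_C_ne_zero c)

/-- The value at a regular point, as a ring homomorphism. -/
noncomputable def evalAt (z : ℂ) : regAt z →+* ℂ where
  toFun f := f.1.eval (RingHom.id ℂ) z
  map_one' := eval_one _ _
  map_mul' f g := eval_mul _ _ f.2 g.2
  map_zero' := eval_zero _ _
  map_add' f g := eval_add _ _ f.2 g.2

open Polynomial in
theorem eval_algebraMap_id (p : ℂ[X]) (z : ℂ) :
    (algebraMap ℂ[X] (RatFunc ℂ) p).eval (RingHom.id ℂ) z = p.eval z := by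
  simp [RatFunc.eval, Polynomial.eval₂_id]

theorem eval_X_sub_C (c z : ℂ) : (X - C c : RatFunc ℂ).eval (RingHom.id ℂ) z = z - c := by
  rw [X_sub_C_eq, eval_algebraMap_id]; simp

theorem eval_mul_of_mem (hf : f ∈ regAt z) (hg : g ∈ regAt z) :
    (f * g).eval (RingHom.id ℂ) z = f.eval (RingHom.id ℂ) z * g.eval (RingHom.id ℂ) z :=
  (evalAt z).map_mul ⟨f, hf⟩ ⟨g, hg⟩

theorem eval_pow_of_mem (hf : f ∈ regAt z) (k : ℕ) :
    (f ^ k).eval (RingHom.id ℂ) z = f.eval (RingHom.id ℂ) z ^ k :=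
  (evalAt z).map_pow ⟨f, hf⟩ k

theorem eval_sub_of_mem (hf : f ∈ regAt z) (hg : g ∈ regAt z) :
    (f - g).eval (RingHom.id ℂ) z = f.eval (RingHom.id ℂ) z - g.eval (RingHom.id ℂ) z :=
  (evalAt z).map_sub ⟨f, hf⟩ ⟨g, hg⟩

theorem eval_sum_of_mem {ι : Type*} (s : Finset ι) (f : ι → RatFunc ℂ)
    (hf : ∀ i, f i ∈ regAt z) :
    (∑ i ∈ s, f i).eval (RingHom.id ℂ) z = ∑ i ∈ s, (f i).eval (RingHom.id ℂ) z := by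
  classical
  induction s using Finset.induction_on with
  | empty => simp
  | insert a s ha ih =>
    rw [Finset.sum_insert ha, Finset.sum_insert ha, ← ih]
    exact (evalAt z).map_add ⟨f a, hf a⟩ ⟨_, sum_mem fun i _ => hf i⟩

theorem eval_ne_zero_of_mul_eq_one (hf : f ∈ regAt z) (hg : g ∈ regAt z) (h : f * g = 1) :
    f.eval (RingHom.id ℂ) z ≠ 0 := by
  intro h0
  have := eval_mul_of_mem hf hg
  rw [h, eval_one, h0, zero_mul] at this
  exact one_ne_zero this

theorem eval_eq_num_div_denom (f : RatFunc ℂ) (z : ℂ) :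
    f.eval (RingHom.id ℂ) z = f.num.eval z / f.denom.eval z := by
  simp [RatFunc.eval, Polynomial.eval₂_id]

theorem inv_mem_regAt (h0 : f.eval (RingHom.id ℂ) z ≠ 0) :
    f⁻¹ ∈ regAt z := by
  have hn : f.num.eval z ≠ 0 := by
    intro h
    rw [eval_eq_num_div_denom, h, zero_div] at h0
    exact h0 rfl
  refine denom_eval_ne_zero_iff.2 ⟨f.denom, f.num, hn, ?_⟩
  conv_lhs => rw [← num_div_denom f]
  rw [inv_div]

theorem X_sub_C_inv_mem_regAt {c : ℂ} (h : z ≠ c) : (X - C c : RatFunc ℂ)⁻¹ ∈ regAt z := by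
  apply inv_mem_regAt
  rw [eval_X_sub_C]
  exact sub_ne_zero.2 h

theorem X_sub_C_inv_not_mem_regAt (z : ℂ) : (X - C z : RatFunc ℂ)⁻¹ ∉ regAt z := by
  intro h
  apply eval_ne_zero_of_mul_eq_one (X_sub_C_mem_regAt z z) h (mul_inv_cancel₀ (X_sub_C_ne_zero z))
  rw [eval_X_sub_C, sub_self]

/-- A regular function that vanishes at `z` is divisible by `X - z`. -/
theorem inv_mul_mem_regAt (hf : f ∈ regAt z) (h0 : f.eval (RingHom.id ℂ) z = 0) :
    (X - C z)⁻¹ * f ∈ regAt z := by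
  rw [eval_eq_num_div_denom, div_eq_zero_iff, or_iff_left hf] at h0
  obtain ⟨r, hr⟩ := Polynomial.dvd_iff_isRoot.2 h0
  refine denom_eval_ne_zero_iff.2 ⟨r, f.denom, hf, ?_⟩
  conv_lhs => rw [← num_div_denom f]
  rw [hr, map_mul, ← X_sub_C_eq, mul_div_assoc, inv_mul_cancel_left₀ (X_sub_C_ne_zero z)]

theorem exists_pow_mul_mem_regAt (f : RatFunc ℂ) (z : ℂ) : ∃ k, (X - C z) ^ k * f ∈ regAt z := by
  obtain ⟨q, hq, hz⟩ := Polynomial.exists_eq_pow_rootMultiplicity_mul_and_not_dvd f.denom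
    (denom_ne_zero f) z
  refine ⟨f.denom.rootMultiplicity z, denom_eval_ne_zero_iff.2 ⟨f.num, q, ?_, ?_⟩⟩
  · intro h
    exact hz (Polynomial.dvd_iff_isRoot.2 h)
  · have h1 : algebraMap (Polynomial ℂ) (RatFunc ℂ) f.denom =
        algebraMap _ _ ((Polynomial.X - Polynomial.C z) ^ f.denom.rootMultiplicity z) *
          algebraMap _ _ q := by
      rw [← map_mul]; exact congrArg _ hq
    have h2 : algebraMap (Polynomial ℂ) (RatFunc ℂ)
        ((Polynomial.X - Polynomial.C z) ^ f.denom.rootMultiplicity z) ≠ 0 :=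
      algebraMap_ne_zero (pow_ne_zero _ (Polynomial.X_sub_C_ne_zero z))
    calc (X - C z) ^ f.denom.rootMultiplicity z * f
        = algebraMap (Polynomial ℂ) (RatFunc ℂ)
            ((Polynomial.X - Polynomial.C z) ^ f.denom.rootMultiplicity z) *
            (algebraMap _ _ f.num / algebraMap _ _ f.denom) := by
          rw [X_sub_C_eq, ← map_pow, num_div_denom]
      _ = _ := by rw [h1, ← mul_div_assoc, mul_div_mul_left _ _ h2]

theorem finite_setOf_not_mem_regAt (f : RatFunc ℂ) : {z | f ∉ regAt z}.Finite := by
  refine (f.denom.roots.toFinset.finite_toSet).subset fun z hz => ?_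
  simpa [mem_regAt, denom_ne_zero] using hz

/-- The numerator has infinitely many roots. This turns pointwise unitarity on the real axis into an
identity of rational matrices. -/
theorem eq_zero_of_eval_real (hf : ∀ x : ℝ, f ∈ regAt (x : ℂ))
    (h : ∀ x : ℝ, f.eval (RingHom.id ℂ) (x : ℂ) = 0) : f = 0 := by
  rw [← num_eq_zero_iff]
  apply Polynomial.eq_zero_of_infinite_isRoot
  refine (Set.infinite_range_of_injective Complex.ofReal_injective).mono ?_
  rintro _ ⟨x, rfl⟩
  have := h x
  rwa [eval_eq_num_div_denom, div_eq_zero_iff, or_iff_left (hf x)] at this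

/-- An entire rational function with a limit at infinity is constant. -/
theorem eq_C_of_tendsto {c : ℂ} (hf : ∀ z, f ∈ regAt z)
    (h : Tendsto (fun z => f.eval (RingHom.id ℂ) z) (cocompact ℂ) (𝓝 c)) : f = C c := by
  have hd : f.denom = 1 := by
    by_contra hne
    have hdeg : f.denom.degree ≠ 0 := by
      intro h0
      exact hne ((monic_denom f).natDegree_eq_zero.1 (Polynomial.natDegree_eq_of_degree_eq_some h0))
    obtain ⟨z, hz⟩ := Complex.exists_root (f := f.denom)
      (by
        rcases lt_or_eq_of_le (Polynomial.zero_le_degree_iff.2 (denom_ne_zero f)) with h1 | h1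
        · exact h1
        · exact absurd h1.symm hdeg)
    exact hf z hz
  have hfe : f = algebraMap _ _ f.num := by
    conv_lhs => rw [← num_div_denom f, hd]
    simp
  have hev : ∀ z, f.eval (RingHom.id ℂ) z = f.num.eval z := fun z => by
    rw [eval_eq_num_div_denom, hd]; simp
  simp only [hev] at h
  have hdeg : ¬ 0 < f.num.degree := by
    intro hpos
    have h1 := Polynomial.tendsto_norm_atTop f.num hpos (tendsto_norm_cocompact_atTop (E := ℂ))
    exact not_tendsto_nhds_of_tendsto_atTop h1 _ h.norm
  have hc := Polynomial.eq_C_of_degree_le_zero (not_lt.1 hdeg)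
  rw [hc] at h
  simp only [Polynomial.eval_C] at h
  have := tendsto_nhds_unique h tendsto_const_nhds
  rw [hfe, hc, ← this, algebraMap_C]

/-! ### Conjugation of the coefficients -/

/-- Conjugation of the coefficients of a rational function. -/
noncomputable def conj : RatFunc ℂ →+* RatFunc ℂ :=
  mapRingHom (Polynomial.mapRingHom (starRingEnd ℂ)) (by
    intro p hp
    rw [Submonoid.mem_comap, mem_nonZeroDivisors_iff_ne_zero]
    rw [mem_nonZeroDivisors_iff_ne_zero] at hp
    simpa using hp)

open Polynomial in
theorem conj_div (p q : ℂ[X]) :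
    conj (algebraMap ℂ[X] (RatFunc ℂ) p / algebraMap _ _ q) =
      algebraMap _ _ (p.map (starRingEnd ℂ)) / algebraMap _ _ (q.map (starRingEnd ℂ)) := by
  change (mapRingHom _ _) _ = _
  rw [coe_mapRingHom_eq_coe_map, map_apply_div]
  rfl

open Polynomial in
theorem conj_algebraMap (p : ℂ[X]) :
    conj (algebraMap ℂ[X] (RatFunc ℂ) p) = algebraMap _ _ (p.map (starRingEnd ℂ)) := by
  simpa using conj_div p 1

theorem conj_conj (f : RatFunc ℂ) : conj (conj f) = f := by
  conv_lhs => rw [← num_div_denom f]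
  rw [conj_div, conj_div, Polynomial.map_map, Polynomial.map_map]
  have : (starRingEnd ℂ).comp (starRingEnd ℂ) = RingHom.id ℂ := by ext; simp
  rw [this, Polynomial.map_id, Polynomial.map_id, num_div_denom]

/-- With this star, `φᴴ` for a rational matrix is the function `λ ↦ φ(conj λ)ᴴ`, which is again
rational and agrees with the pointwise adjoint on the real axis. -/
noncomputable instance instStarRing : StarRing (RatFunc ℂ) where
  star := conj
  star_involutive := conj_conj
  star_mul f g := by rw [map_mul, mul_comm]
  star_add f g := map_add conj f g

theorem star_eq_conj (f : RatFunc ℂ) : star f = conj f := rfl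

theorem star_C (c : ℂ) : star (C c : RatFunc ℂ) = C (star c) := by
  rw [star_eq_conj, ← algebraMap_C, conj_algebraMap]; simp

theorem star_X_sub_C (c : ℂ) : star (X - C c : RatFunc ℂ) = X - C (star c) := by
  rw [X_sub_C_eq, star_eq_conj, conj_algebraMap]; simp

open Polynomial in
theorem eval_map_star (p : ℂ[X]) (z : ℂ) :
    (p.map (starRingEnd ℂ)).eval (star z) = star (p.eval z) := by
  rw [Polynomial.eval_map]
  exact (Polynomial.hom_eval₂ p (RingHom.id ℂ) (starRingEnd ℂ) z).symm

theorem star_mem_regAt (hf : f ∈ regAt z) : star f ∈ regAt (star z) := by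
  refine denom_eval_ne_zero_iff.2 ⟨f.num.map (starRingEnd ℂ), f.denom.map (starRingEnd ℂ), ?_, ?_⟩
  · rw [eval_map_star]; exact star_ne_zero.2 hf
  · rw [← conj_div, num_div_denom, star_eq_conj]

theorem star_mem_regAt_iff : star f ∈ regAt z ↔ f ∈ regAt (star z) :=
  ⟨fun h => by simpa using star_mem_regAt h, fun h => by simpa using star_mem_regAt h⟩

theorem eval_star (hf : f ∈ regAt z) :
    (star f).eval (RingHom.id ℂ) (star z) = star (f.eval (RingHom.id ℂ) z) := by
  have h1 := eval_mul_of_mem (star_mem_regAt hf)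
    (algebraMap_mem_regAt (f.denom.map (starRingEnd ℂ)) (star z))
  have hd : algebraMap (Polynomial ℂ) (RatFunc ℂ) f.denom ≠ 0 := algebraMap_ne_zero (denom_ne_zero f)
  have h2 : star f * algebraMap _ _ (f.denom.map (starRingEnd ℂ)) =
      algebraMap _ _ (f.num.map (starRingEnd ℂ)) := by
    rw [star_eq_conj, ← conj_algebraMap, ← conj_algebraMap, ← map_mul]
    congr 1
    conv_lhs => rw [← num_div_denom f]
    rw [num_div_denom]
    exact (eq_div_iff hd).1 (num_div_denom f).symm
  rw [h2, eval_algebraMap_id, eval_algebraMap_id, eval_map_star, eval_map_star] at h1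
  have hne : star (f.denom.eval z) ≠ 0 := star_ne_zero.2 hf
  rw [eval_eq_num_div_denom f z, star_div₀, h1, mul_div_cancel_right₀ _ hne]

end RatFunc

/-! ### Regular matrices and unitary loops -/

namespace MeroMatrix

open RatFunc Matrix

variable {n : ℕ} {φ ψ : MeroMatrix n} {z : ℂ}

/-- No entry has a pole at `z`. -/
def RegularAt (φ : MeroMatrix n) (z : ℂ) : Prop := ∀ a b, φ a b ∈ regAt z

theorem not_hasPole_iff : ¬ φ.HasPole z ↔ φ.RegularAt z := by
  simp [HasPole, RegularAt, mem_regAt]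

theorem hasPole_iff : φ.HasPole z ↔ ¬ φ.RegularAt z := by
  rw [← not_hasPole_iff, not_not]

theorem RegularAt.add (hφ : φ.RegularAt z) (hψ : ψ.RegularAt z) : RegularAt (φ + ψ) z :=
  fun a b => add_mem (hφ a b) (hψ a b)

theorem RegularAt.mul (hφ : φ.RegularAt z) (hψ : ψ.RegularAt z) : RegularAt (φ * ψ) z :=
  fun a b => by
    rw [Matrix.mul_apply]
    exact sum_mem fun i _ => mul_mem (hφ a i) (hψ i b)

theorem RegularAt.smul {f : RatFunc ℂ} (hf : f ∈ regAt z) (hφ : φ.RegularAt z) :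
    RegularAt (f • φ) z :=
  fun a b => mul_mem hf (hφ a b)

theorem regularAt_map_C (A : Matrix (Fin n) (Fin n) ℂ) (z : ℂ) :
    RegularAt (A.map C : MeroMatrix n) z :=
  fun _ _ => C_mem_regAt _ _

theorem regularAt_one (z : ℂ) : RegularAt (1 : MeroMatrix n) z := by
  have := regularAt_map_C (1 : Matrix (Fin n) (Fin n) ℂ) z
  rwa [Matrix.map_one _ (map_zero _) (map_one _)] at this

theorem RegularAt.det (hφ : φ.RegularAt z) : φ.det ∈ regAt z := by
  rw [Matrix.det_apply']
  exact sum_mem fun σ _ => mul_mem (intCast_mem _ _) (prod_mem fun i _ => hφ _ _)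

theorem regularAt_conjTranspose : RegularAt (φᴴ : MeroMatrix n) z ↔ φ.RegularAt (star z) := by
  constructor
  · intro h a b
    exact star_mem_regAt_iff.1 (h b a)
  · intro h a b
    exact star_mem_regAt_iff.2 (h b a)

theorem value_mul (hφ : φ.RegularAt z) (hψ : ψ.RegularAt z) :
    value (φ * ψ) z = φ.value z * ψ.value z := by
  ext a b
  simp only [value, Matrix.map_apply, Matrix.mul_apply]
  rw [eval_sum_of_mem _ _ fun i => mul_mem (hφ a i) (hψ i b)]
  exact Finset.sum_congr rfl fun i _ => eval_mul_of_mem (hφ a i) (hψ i b)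

theorem value_smul {f : RatFunc ℂ} (hf : f ∈ regAt z) (hφ : φ.RegularAt z) :
    value (f • φ) z = f.eval (RingHom.id ℂ) z • φ.value z := by
  ext a b
  exact eval_mul_of_mem hf (hφ a b)

theorem value_map_C (A : Matrix (Fin n) (Fin n) ℂ) (z : ℂ) :
    value (A.map C : MeroMatrix n) z = A := by
  ext a b
  simp [value]

theorem value_one (z : ℂ) : value (1 : MeroMatrix n) z = 1 := by
  have := value_map_C (1 : Matrix (Fin n) (Fin n) ℂ) z
  rwa [Matrix.map_one _ (map_zero _) (map_one _)] at this

theorem value_conjTranspose (hφ : φ.RegularAt z) : value (φᴴ : MeroMatrix n) (star z) =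
    (φ.value z)ᴴ := by
  ext a b
  exact eval_star (hφ b a)

/-- A regular matrix that vanishes at `z` is divisible by `X - z`. -/
theorem RegularAt.inv_smul (hφ : φ.RegularAt z) (h0 : φ.value z = 0) :
    RegularAt ((X - C z)⁻¹ • φ) z :=
  fun a b => inv_mul_mem_regAt (hφ a b) (congrFun (congrFun h0 a) b)

theorem finite_setOf_hasPole (φ : MeroMatrix n) : {z | φ.HasPole z}.Finite := by
  have : {z | φ.HasPole z} = ⋃ a, ⋃ b, {z | φ a b ∉ regAt z} := by
    ext z
    simp [HasPole, mem_regAt]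
  rw [this]
  exact Set.finite_iUnion fun a => Set.finite_iUnion fun b => finite_setOf_not_mem_regAt _

theorem eventually_regularAt (φ : MeroMatrix n) : ∀ᶠ z in cocompact ℂ, φ.RegularAt z := by
  have h := (finite_setOf_hasPole φ).isCompact.compl_mem_cocompact
  filter_upwards [h] with z hz
  exact not_hasPole_iff.1 hz

/-- The algebraic form of a unitary loop. -/
structure IsLoop (φ : MeroMatrix n) : Prop where
  conjTranspose_mul : φᴴ * φ = 1
  regularAt_ofReal : ∀ x : ℝ, φ.RegularAt (x : ℂ)
  tendsto : Tendsto φ.value (cocompact ℂ) (𝓝 1)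

theorem star_ofReal (x : ℝ) : star (x : ℂ) = x := Complex.conj_ofReal x

theorem isUnitaryLoop_iff : φ.IsUnitaryLoop ↔ φ.IsLoop := by
  constructor
  · rintro ⟨h1, h2⟩
    have hr : ∀ x : ℝ, φ.RegularAt (x : ℂ) := fun x => not_hasPole_iff.1 (h1 x).1
    have hr' : ∀ x : ℝ, RegularAt (φᴴ : MeroMatrix n) (x : ℂ) := fun x =>
      regularAt_conjTranspose.2 (by rw [star_ofReal]; exact hr x)
    refine ⟨?_, hr, h2⟩
    rw [← sub_eq_zero]
    ext a b
    refine eq_zero_of_eval_real (fun x => sub_mem ((hr' x).mul (hr x) a b) (regularAt_one _ a b)) ?_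
    intro x
    have e1 : value (φᴴ * φ) (x : ℂ) = 1 := by
      have hv := value_conjTranspose (hr x)
      rw [star_ofReal] at hv
      rw [value_mul (hr' x) (hr x), hv]
      exact Matrix.mem_unitaryGroup_iff'.1 (h1 x).2
    rw [Matrix.sub_apply, eval_sub_of_mem ((hr' x).mul (hr x) a b) (regularAt_one _ a b)]
    have e2 := congrFun (congrFun (e1.trans (value_one (x : ℂ)).symm) a) b
    exact sub_eq_zero.2 e2
  · intro h
    refine ⟨fun x => ⟨not_hasPole_iff.2 (h.regularAt_ofReal x), ?_⟩, h.tendsto⟩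
    have hr := h.regularAt_ofReal x
    have hr' : RegularAt (φᴴ : MeroMatrix n) (x : ℂ) :=
      regularAt_conjTranspose.2 (by rw [star_ofReal]; exact hr)
    have hv := value_conjTranspose hr
    rw [star_ofReal] at hv
    rw [Matrix.mem_unitaryGroup_iff', Matrix.star_eq_conjTranspose, ← hv, ← value_mul hr' hr,
      h.conjTranspose_mul, value_one]

theorem IsLoop.mul_conjTranspose (h : φ.IsLoop) : φ * φᴴ = 1 :=
  mul_eq_one_comm.1 h.conjTranspose_mul

theorem IsLoop.one : IsLoop (1 : MeroMatrix n) where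
  conjTranspose_mul := by simp
  regularAt_ofReal _ := regularAt_one _
  tendsto := by
    have : value (1 : MeroMatrix n) = fun _ => 1 := funext value_one
    rw [this]; exact tendsto_const_nhds

theorem IsLoop.mul (hφ : φ.IsLoop) (hψ : ψ.IsLoop) : IsLoop (φ * ψ) where
  conjTranspose_mul := by
    rw [Matrix.conjTranspose_mul, Matrix.mul_assoc, ← Matrix.mul_assoc φᴴ, hφ.conjTranspose_mul,
      Matrix.one_mul, hψ.conjTranspose_mul]
  regularAt_ofReal x := (hφ.regularAt_ofReal x).mul (hψ.regularAt_ofReal x)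
  tendsto := by
    have h := hφ.tendsto.mul hψ.tendsto
    rw [Matrix.one_mul] at h
    refine h.congr' ?_
    filter_upwards [eventually_regularAt φ, eventually_regularAt ψ] with z h1 h2
    exact (value_mul h1 h2).symm

theorem tendsto_star_cocompact : Tendsto (star : ℂ → ℂ) (cocompact ℂ) (cocompact ℂ) :=
  (Complex.conjCLE.toHomeomorph.isClosedEmbedding).tendsto_cocompact

theorem IsLoop.conjTranspose (hφ : φ.IsLoop) : IsLoop (φᴴ : MeroMatrix n) where
  conjTranspose_mul := by rw [Matrix.conjTranspose_conjTranspose]; exact hφ.mul_conjTranspose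
  regularAt_ofReal x := regularAt_conjTranspose.2 (by
    rw [star_ofReal]; exact hφ.regularAt_ofReal x)
  tendsto := by
    have h : Tendsto (fun z => (φ.value (star z))ᴴ) (cocompact ℂ) (𝓝 (1ᴴ)) :=
      ((continuous_id.matrix_conjTranspose).tendsto 1).comp
        (hφ.tendsto.comp tendsto_star_cocompact)
    rw [Matrix.conjTranspose_one] at h
    refine h.congr' ?_
    filter_upwards [tendsto_star_cocompact.eventually (eventually_regularAt φ)] with z hz
    rw [← value_conjTranspose hz, star_star]

/-- A loop without poles is trivial. -/
theorem IsLoop.eq_one (hφ : φ.IsLoop) (h : ∀ z, φ.RegularAt z) : φ = 1 := by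
  ext a b
  have h1 : Tendsto (fun z => (φ a b).eval (RingHom.id ℂ) z) (cocompact ℂ)
      (𝓝 ((1 : Matrix (Fin n) (Fin n) ℂ) a b)) :=
    ((continuous_id.matrix_elem a b).tendsto _).comp hφ.tendsto
  rw [eq_C_of_tendsto (fun z => h z a b) h1]
  rcases eq_or_ne a b with rfl | hab
  · simp
  · simp [hab]

theorem mem_loopG_iff : φ ∈ loopG n ↔ φ.IsLoop ∧ ∀ z : ℂ, 0 < z.im → φ.RegularAt z := by
  simp only [loopG, Set.mem_ofPred_eq, isUnitaryLoop_iff, not_hasPole_iff]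

theorem mem_loopM_iff : φ ∈ loopM n ↔ φ.IsLoop ∧ ∀ z : ℂ, z.im < 0 → φ.RegularAt z := by
  simp only [loopM, Set.mem_ofPred_eq, isUnitaryLoop_iff, not_hasPole_iff]

theorem regularAt_of_im_eq_zero (h : φ.IsLoop) (hz : z.im = 0) : φ.RegularAt z := by
  have : z = (z.re : ℂ) := Complex.ext rfl (by simpa using hz)
  rw [this]; exact h.regularAt_ofReal _

end MeroMatrix

/-! ### Orthogonal projections -/

namespace Matrix

variable {n : ℕ}

/-- The orthogonal projection onto the span of the columns of the unitary `U` with index in `S`. -/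
def spanProj (U : unitaryGroup (Fin n) ℂ) (S : Finset (Fin n)) : Matrix (Fin n) (Fin n) ℂ :=
  U.1 * diagonal (fun i => if i ∈ S then 1 else 0) * (U.1)ᴴ

variable (U : unitaryGroup (Fin n) ℂ) (S T : Finset (Fin n))

theorem conjTranspose_mul_unitary : (U.1)ᴴ * U.1 = 1 := mem_unitaryGroup_iff'.1 U.2

theorem unitary_mul_conjTranspose : U.1 * (U.1)ᴴ = 1 := mem_unitaryGroup_iff.1 U.2

theorem spanProj_mul : spanProj U S * spanProj U T = spanProj U (S ∩ T) := by
  have : spanProj U S * spanProj U T = U.1 * (diagonal (fun i => if i ∈ S then 1 else 0) *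
      ((U.1)ᴴ * U.1) * diagonal (fun i => if i ∈ T then 1 else 0)) * (U.1)ᴴ := by
    simp only [spanProj, Matrix.mul_assoc]
  rw [this, conjTranspose_mul_unitary, Matrix.mul_one, diagonal_mul_diagonal, spanProj]
  congr 3
  ext i
  by_cases h1 : i ∈ S <;> by_cases h2 : i ∈ T <;> simp [h1, h2]

theorem conjTranspose_spanProj : (spanProj U S)ᴴ = spanProj U S := by
  rw [spanProj, conjTranspose_mul, conjTranspose_mul, conjTranspose_conjTranspose,
    diagonal_conjTranspose, Matrix.mul_assoc]
  congr 3
  ext i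
  by_cases h1 : i ∈ S <;> simp [h1]

theorem isStarProjection_spanProj : IsStarProjection (spanProj U S) where
  isIdempotentElem := by rw [IsIdempotentElem, spanProj_mul, Finset.inter_self]
  isSelfAdjoint := conjTranspose_spanProj U S

theorem spanProj_empty : spanProj U ∅ = 0 := by simp [spanProj]

theorem spanProj_univ : spanProj U Finset.univ = 1 := by
  simp [spanProj, unitary_mul_conjTranspose]

theorem spanProj_add (h : Disjoint S T) : spanProj U S + spanProj U T = spanProj U (S ∪ T) := by
  rw [spanProj, spanProj, ← Matrix.add_mul, ← Matrix.mul_add, diagonal_add, spanProj]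
  congr 3
  ext i
  by_cases h1 : i ∈ S
  · have h2 := Finset.disjoint_left.1 h h1
    simp [h1, h2]
  · by_cases h2 : i ∈ T <;> simp [h1, h2]

theorem one_sub_spanProj : 1 - spanProj U S = spanProj U Sᶜ := by
  rw [sub_eq_iff_eq_add', spanProj_add U S Sᶜ disjoint_compl_right, Finset.union_compl,
    spanProj_univ]

theorem isUnit_det_unitary : IsUnit (U.1).det :=
  (isUnit_iff_isUnit_det _).1 (IsUnit.of_mul_eq_one _ (unitary_mul_conjTranspose U))

theorem rank_spanProj : (spanProj U S).rank = S.card := by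
  have h2 : IsUnit ((U.1)ᴴ).det :=
    (isUnit_iff_isUnit_det _).1 (IsUnit.of_mul_eq_one _ (conjTranspose_mul_unitary U))
  rw [spanProj, rank_mul_eq_left_of_isUnit_det _ _ h2,
    rank_mul_eq_right_of_isUnit_det _ _ (isUnit_det_unitary U), rank_diagonal]
  simp

theorem IsHermitian.exists_eq_diagonal {A : Matrix (Fin n) (Fin n) ℂ} (hA : A.IsHermitian) :
    ∃ (U : unitaryGroup (Fin n) ℂ) (d : Fin n → ℂ), A = U.1 * diagonal d * (U.1)ᴴ := by
  refine ⟨hA.eigenvectorUnitary, RCLike.ofReal ∘ hA.eigenvalues, hA.spectral_theorem.trans ?_⟩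
  rw [Unitary.conjStarAlgAut_apply]
  rfl

/-- An idempotent Hermitian matrix has eigenvalues `0` and `1` only. Rank questions thereby become
questions about cardinalities of index sets. -/
theorem exists_eq_spanProj {P : Matrix (Fin n) (Fin n) ℂ} (hP : IsStarProjection P) :
    ∃ (U : unitaryGroup (Fin n) ℂ) (S : Finset (Fin n)), P = spanProj U S := by
  obtain ⟨U, d, hd⟩ := IsHermitian.exists_eq_diagonal (A := P) hP.isSelfAdjoint
  have h1 : (U.1)ᴴ * P * U.1 = diagonal d := by
    rw [hd]
    calc _ = ((U.1)ᴴ * U.1) * diagonal d * ((U.1)ᴴ * U.1) := by simp only [Matrix.mul_assoc]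
      _ = _ := by rw [conjTranspose_mul_unitary]; simp
  have h2 : diagonal d * diagonal d = diagonal d := by
    rw [← h1]
    calc _ = (U.1)ᴴ * (P * (U.1 * (U.1)ᴴ) * P) * U.1 := by simp only [Matrix.mul_assoc]
      _ = _ := by
        rw [unitary_mul_conjTranspose, Matrix.mul_one, hP.isIdempotentElem.eq]
  rw [diagonal_mul_diagonal] at h2
  have h3 : ∀ i, d i = 0 ∨ d i = 1 := fun i => by
    have := congrFun (diagonal_injective h2) i
    simpa using (IsIdempotentElem.iff_eq_zero_or_one (p := d i)).1 this
  refine ⟨U, Finset.univ.filter (fun i => d i = 1), ?_⟩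
  rw [hd, spanProj]
  congr 3
  ext i
  rcases h3 i with h | h <;> simp [h]

theorem rank_eq_card_iff_of_isStarProjection {P : Matrix (Fin n) (Fin n) ℂ}
    (hP : IsStarProjection P) : P.rank = n ↔ P = 1 := by
  obtain ⟨U, S, rfl⟩ := exists_eq_spanProj hP
  constructor
  · intro h
    rw [rank_spanProj] at h
    rw [(Finset.card_eq_iff_eq_univ S).1 (by simpa using h), spanProj_univ]
  · intro h
    rw [h, rank_one, Fintype.card_fin]

theorem eq_zero_of_rank_eq_zero_of_isStarProjection {P : Matrix (Fin n) (Fin n) ℂ}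
    (hP : IsStarProjection P) (h : P.rank = 0) : P = 0 := by
  obtain ⟨U, S, rfl⟩ := exists_eq_spanProj hP
  rw [rank_spanProj, Finset.card_eq_zero] at h
  rw [h, spanProj_empty]

theorem rank_le_pred_of_isStarProjection {P : Matrix (Fin n) (Fin n) ℂ} (hP : IsStarProjection P)
    (h1 : P ≠ 1) : P.rank ≤ n - 1 := by
  have h2 : P.rank ≤ n := by simpa using P.rank_le_card_width
  have h3 := mt (rank_eq_card_iff_of_isStarProjection hP).1 h1
  omega

/-- A projection other than `1` can be enlarged by an orthogonal projection of rank one. -/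
theorem exists_rank_one_orthogonal {P : Matrix (Fin n) (Fin n) ℂ} (hP : IsStarProjection P)
    (h1 : P ≠ 1) : ∃ E : Matrix (Fin n) (Fin n) ℂ, IsStarProjection E ∧ P * E = 0 ∧ E * P = 0 ∧
      IsStarProjection (P + E) ∧ (P + E).rank = P.rank + 1 ∧ (1 - E).rank = n - 1 := by
  obtain ⟨U, S, rfl⟩ := exists_eq_spanProj hP
  have hS : S ≠ Finset.univ := by
    rintro rfl
    exact h1 (spanProj_univ U)
  obtain ⟨i, hi⟩ : ∃ i, i ∉ S := by
    by_contra h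
    push Not at h
    exact hS (Finset.eq_univ_iff_forall.2 h)
  have hd : Disjoint S {i} := Finset.disjoint_singleton_right.2 hi
  refine ⟨spanProj U {i}, isStarProjection_spanProj U _, ?_, ?_, ?_, ?_, ?_⟩
  · rw [spanProj_mul, Finset.disjoint_iff_inter_eq_empty.1 hd, spanProj_empty]
  · rw [spanProj_mul, Finset.disjoint_iff_inter_eq_empty.1 hd.symm, spanProj_empty]
  · rw [spanProj_add U _ _ hd]; exact isStarProjection_spanProj U _
  · rw [spanProj_add U _ _ hd, rank_spanProj, rank_spanProj, Finset.card_union_of_disjoint hd,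
      Finset.card_singleton]
  · rw [one_sub_spanProj, rank_spanProj, Finset.card_compl, Finset.card_singleton, Fintype.card_fin]

open scoped ComplexOrder in
/-- The orthogonal projection onto the range of a matrix. -/
theorem exists_rangeProj (A : Matrix (Fin n) (Fin n) ℂ) :
    ∃ P : Matrix (Fin n) (Fin n) ℂ, IsStarProjection P ∧ P * A = A ∧
      ∀ B : Matrix (Fin n) (Fin n) ℂ, Aᴴ * B = 0 → P * B = 0 := by
  obtain ⟨U, d, hd⟩ := IsHermitian.exists_eq_diagonal (isHermitian_mul_conjTranspose_self A)
  -- The range of `A` is that of `A * Aᴴ`, hence is spanned by the eigenvectors with nonzero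
  -- eigenvalue.
  set S : Finset (Fin n) := Finset.univ.filter (fun i => d i ≠ 0) with hS
  have hPH : spanProj U S * (A * Aᴴ) = A * Aᴴ := by
    rw [hd, spanProj]
    calc _ = U.1 * (diagonal (fun i => if i ∈ S then 1 else 0) * ((U.1)ᴴ * U.1) * diagonal d) *
          (U.1)ᴴ := by simp only [Matrix.mul_assoc]
      _ = _ := by
        rw [conjTranspose_mul_unitary, Matrix.mul_one, diagonal_mul_diagonal]
        congr 3
        ext i
        by_cases h : d i = 0 <;> simp [hS, h]
  have hPK : ∃ K, spanProj U S = K * (A * Aᴴ) := by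
    -- This is the pseudoinverse of `A * Aᴴ`: the convention `0⁻¹ = 0` makes `(d i)⁻¹ * d i` the
    -- indicator of `S`.
    refine ⟨U.1 * diagonal (fun i => (d i)⁻¹) * (U.1)ᴴ, ?_⟩
    rw [hd, spanProj]
    symm
    calc _ = U.1 * (diagonal (fun i => (d i)⁻¹) * ((U.1)ᴴ * U.1) * diagonal d) *
          (U.1)ᴴ := by simp only [Matrix.mul_assoc]
      _ = _ := by
        rw [conjTranspose_mul_unitary, Matrix.mul_one, diagonal_mul_diagonal]
        congr 3
        ext i
        by_cases h : d i = 0 <;> simp [hS, h]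
  refine ⟨spanProj U S, isStarProjection_spanProj U S, ?_, ?_⟩
  · have h0 : (A - spanProj U S * A) * (A - spanProj U S * A)ᴴ = 0 := by
      rw [conjTranspose_sub, conjTranspose_mul, conjTranspose_spanProj, Matrix.sub_mul,
        Matrix.mul_sub, Matrix.mul_sub]
      have e1 : spanProj U S * A * Aᴴ = A * Aᴴ := by rw [Matrix.mul_assoc, hPH]
      have e2 : spanProj U S * A * (Aᴴ * spanProj U S) = A * (Aᴴ * spanProj U S) := by
        rw [← Matrix.mul_assoc, e1, Matrix.mul_assoc]
      rw [e1, e2, sub_self]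
    have := self_mul_conjTranspose_eq_zero.1 h0
    exact (sub_eq_zero.1 this).symm
  · intro B hB
    obtain ⟨K, hK⟩ := hPK
    rw [hK, Matrix.mul_assoc, Matrix.mul_assoc, hB, Matrix.mul_zero, Matrix.mul_zero]

end Matrix

/-! ### Basic loops and their products -/

namespace BasicParam

open RatFunc Matrix MeroMatrix

variable {n : ℕ} {α z : ℂ}

theorem X_sub_C_mul_theta (α : ℂ) : (X - C α) * theta α = X - C (star α) := by
  rw [theta, mul_div_cancel₀ _ (X_sub_C_ne_zero α)]
  rfl

theorem star_theta (α : ℂ) : star (theta α) = theta (star α) := by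
  change star ((X - C (star α)) / (X - C α)) = (X - C (star (star α))) / (X - C (star α))
  rw [star_div₀, star_X_sub_C, star_X_sub_C]

theorem theta_mul_theta_star (α : ℂ) : theta α * theta (star α) = 1 := by
  have h1 := X_sub_C_ne_zero α
  have h2 := X_sub_C_ne_zero (star α)
  change (X - C (star α)) / (X - C α) * ((X - C (star (star α))) / (X - C (star α))) = 1
  rw [star_star]
  field_simp

theorem theta_ne_zero (α : ℂ) : theta α ≠ 0 :=
  left_ne_zero_of_mul_eq_one (theta_mul_theta_star α)

theorem theta_mem_regAt (h : z ≠ α) : theta α ∈ regAt z := by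
  rw [theta, div_eq_mul_inv]
  exact mul_mem (X_sub_C_mem_regAt _ _) (X_sub_C_inv_mem_regAt h)

theorem tendsto_eval_theta (α : ℂ) :
    Tendsto (fun z => (theta α).eval (RingHom.id ℂ) z) (cocompact ℂ) (𝓝 1) := by
  -- The partial fraction form of `θ_α`.
  have h1 : Tendsto (fun z : ℂ => 1 + (α - star α) * (z - α)⁻¹) (cocompact ℂ) (𝓝 1) := by
    have h2 : Tendsto (fun z : ℂ => z - α) (cocompact ℂ) (cocompact ℂ) :=
      (Homeomorph.subRight α).isClosedEmbedding.tendsto_cocompact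
    have h3 : Tendsto (fun z : ℂ => (z - α)⁻¹) (cocompact ℂ) (𝓝 0) := by
      rw [← Metric.cobounded_eq_cocompact] at h2 ⊢
      exact tendsto_inv₀_cobounded.comp h2
    simpa using (h3.const_mul (α - star α)).const_add 1
  refine h1.congr' ?_
  filter_upwards [(isCompact_singleton (x := α)).compl_mem_cocompact] with z hz
  have hz : z ≠ α := hz
  have h4 := eval_mul_of_mem (X_sub_C_mem_regAt α z) (theta_mem_regAt hz)
  rw [X_sub_C_mul_theta, eval_X_sub_C, eval_X_sub_C] at h4
  have h5 : z - α ≠ 0 := sub_ne_zero.2 hz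
  rw [← mul_right_inj' h5, ← h4, mul_add, mul_left_comm, mul_inv_cancel₀ h5]
  ring

/-- The loop `P^⊥ + θ_α P` for an arbitrary matrix `P`. -/
noncomputable def projLoop (α : ℂ) (P : Matrix (Fin n) (Fin n) ℂ) : MeroMatrix n :=
  (1 - P).map C + theta α • P.map C

theorem loop_eq (p : BasicParam n) : p.loop = projLoop p.pole p.proj := rfl

theorem map_C_mul (A B : Matrix (Fin n) (Fin n) ℂ) :
    (A * B).map (C : ℂ →+* RatFunc ℂ) = A.map C * B.map C := Matrix.map_mul

theorem map_C_one : (1 : Matrix (Fin n) (Fin n) ℂ).map (C : ℂ →+* RatFunc ℂ) = 1 :=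
  Matrix.map_one _ (map_zero _) (map_one _)

theorem map_C_add (A B : Matrix (Fin n) (Fin n) ℂ) :
    (A + B).map (C : ℂ →+* RatFunc ℂ) = A.map C + B.map C := Matrix.map_add _ (map_add _) _ _

theorem map_C_sub (A B : Matrix (Fin n) (Fin n) ℂ) :
    (A - B).map (C : ℂ →+* RatFunc ℂ) = A.map C - B.map C := Matrix.map_sub _ (map_sub _) _ _

theorem map_C_conjTranspose (A : Matrix (Fin n) (Fin n) ℂ) :
    (A.map (C : ℂ →+* RatFunc ℂ))ᴴ = Aᴴ.map C := by
  ext a b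
  simp [star_C]

theorem projLoop_eq (α : ℂ) (P : Matrix (Fin n) (Fin n) ℂ) :
    projLoop α P = 1 + (theta α - 1) • P.map C := by
  rw [projLoop, map_C_sub, map_C_one, sub_smul, one_smul]
  abel

theorem projLoop_one (α : ℂ) : projLoop α (1 : Matrix (Fin n) (Fin n) ℂ) = theta α • 1 := by
  rw [projLoop_eq, map_C_one, sub_smul, one_smul]
  abel

theorem projLoop_zero (α : ℂ) : projLoop α (0 : Matrix (Fin n) (Fin n) ℂ) = 1 := by
  rw [projLoop_eq]
  simp

/-- Since `θ_α` and `θ_{star α}` are inverse to each other, multiplication by `θ_α` exchanges the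
roles of `P` and its complement. This is what relates the involution to the adjoint. -/
theorem theta_smul_projLoop_star (α : ℂ) (P : Matrix (Fin n) (Fin n) ℂ) :
    theta α • projLoop (star α) P = projLoop α (1 - P) := by
  rw [projLoop_eq, projLoop_eq, smul_add, smul_smul, mul_sub, theta_mul_theta_star, mul_one,
    map_C_sub, map_C_one]
  simp only [sub_smul, smul_sub, one_smul]
  abel

variable {P E : Matrix (Fin n) (Fin n) ℂ}

theorem conjTranspose_projLoop (α : ℂ) (hP : IsStarProjection P) :
    (projLoop α P)ᴴ = projLoop (star α) P := by
  have h : Pᴴ = P := hP.isSelfAdjoint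
  rw [projLoop_eq, projLoop_eq, conjTranspose_add, conjTranspose_one, conjTranspose_smul,
    map_C_conjTranspose, h, star_sub, star_theta, star_one]

theorem projLoop_star_mul (α : ℂ) (hP : IsStarProjection P) :
    projLoop (star α) P * projLoop α P = 1 := by
  have h : P.map (C : ℂ →+* RatFunc ℂ) * P.map C = P.map C := by
    rw [← map_C_mul, hP.isIdempotentElem.eq]
  simp only [projLoop_eq, Matrix.add_mul, Matrix.mul_add, Matrix.smul_mul, Matrix.mul_smul, h,
    Matrix.one_mul, Matrix.mul_one, smul_add, smul_smul]
  rw [add_assoc, ← add_smul, ← add_smul]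
  have := theta_mul_theta_star α
  have h0 : theta (star α) - 1 + (theta α - 1 + (theta α - 1) * (theta (star α) - 1)) = 0 := by
    linear_combination this
  rw [h0, zero_smul, add_zero]

theorem projLoop_mul_star (α : ℂ) (hP : IsStarProjection P) :
    projLoop α P * projLoop (star α) P = 1 := mul_eq_one_comm.1 (projLoop_star_mul α hP)

/-- A scalar factor can be absorbed by a basic loop of smaller rank. -/
theorem projLoop_add_mul (α : ℂ) (hE : IsStarProjection E) (h1 : P * E = 0) :
    projLoop α (P + E) * projLoop α (1 - E) = theta α • projLoop α P := by
  have hEE : E.map (C : ℂ →+* RatFunc ℂ) * E.map C = E.map C := by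
    rw [← map_C_mul, hE.isIdempotentElem.eq]
  have hPE : P.map (C : ℂ →+* RatFunc ℂ) * E.map C = 0 := by
    rw [← map_C_mul, h1]; simp
  have h2 : projLoop α (1 - E) = theta α • 1 - (theta α - 1) • E.map C := by
    rw [projLoop_eq, map_C_sub, map_C_one, smul_sub, sub_smul, sub_smul]
    simp only [one_smul]
    abel
  simp only [h2, projLoop_eq, map_C_add, Matrix.mul_sub, Matrix.add_mul, Matrix.smul_mul,
    Matrix.mul_smul, hPE, hEE, Matrix.one_mul, Matrix.mul_one, zero_add]
  ext a b
  simp only [Matrix.add_apply, Matrix.sub_apply, Matrix.smul_apply, smul_eq_mul]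
  ring

theorem regularAt_projLoop (P : Matrix (Fin n) (Fin n) ℂ) (h : z ≠ α) :
    (projLoop α P).RegularAt z :=
  (regularAt_map_C _ _).add (.smul (theta_mem_regAt h) (regularAt_map_C _ _))

theorem regularAt_X_sub_C_smul_projLoop (α : ℂ) (P : Matrix (Fin n) (Fin n) ℂ) :
    RegularAt ((X - C α) • projLoop α P) α := by
  rw [projLoop, smul_add, smul_smul, X_sub_C_mul_theta]
  exact .add (.smul (X_sub_C_mem_regAt _ _) (regularAt_map_C _ _))
    (.smul (X_sub_C_mem_regAt _ _) (regularAt_map_C _ _))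

theorem isLoop_projLoop (hα : α.im ≠ 0) (hP : IsStarProjection P) : (projLoop α P).IsLoop where
  conjTranspose_mul := by rw [conjTranspose_projLoop α hP, projLoop_star_mul α hP]
  regularAt_ofReal x := regularAt_projLoop P (by
    rintro rfl
    simp at hα)
  tendsto := by
    have h1 : Tendsto (fun z => (1 - P) + (theta α).eval (RingHom.id ℂ) z • P) (cocompact ℂ)
        (𝓝 ((1 - P) + (1 : ℂ) • P)) := ((tendsto_eval_theta α).smul_const P).const_add _
    rw [one_smul, sub_add_cancel] at h1
    refine h1.congr' ?_
    filter_upwards [(isCompact_singleton (x := α)).compl_mem_cocompact] with z hz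
    have hz : z ≠ α := hz
    ext a b
    have e2 := eval_mul_of_mem (theta_mem_regAt hz) (C_mem_regAt (P a b) z)
    have e3 := (evalAt z).map_add ⟨C ((1 - P) a b), C_mem_regAt _ _⟩
      ⟨theta α * C (P a b), mul_mem (theta_mem_regAt hz) (C_mem_regAt _ _)⟩
    change (C ((1 - P) a b) + theta α * C (P a b)).eval (RingHom.id ℂ) z =
      (C ((1 - P) a b)).eval (RingHom.id ℂ) z +
      (theta α * C (P a b)).eval (RingHom.id ℂ) z at e3
    rw [e2, eval_C, eval_C] at e3
    exact e3.symm

/-- In an orthonormal eigenbasis of `P` the loop is diagonal, with entry `θ` once for each dimension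
of the range. -/
theorem det_projLoop (α : ℂ) (hP : IsStarProjection P) :
    (projLoop α P).det = theta α ^ P.rank := by
  obtain ⟨U, S, rfl⟩ := exists_eq_spanProj hP
  have hU : (U.1).map (C : ℂ →+* RatFunc ℂ) * (U.1)ᴴ.map C = 1 := by
    rw [← map_C_mul, unitary_mul_conjTranspose, map_C_one]
  have h1 : projLoop α (spanProj U S) = (U.1).map C *
      diagonal (fun i => if i ∈ S then theta α else 1) * (U.1)ᴴ.map C := by
    have h2 : diagonal (fun i => if i ∈ S then theta α else 1) =
        1 + (theta α - 1) • (diagonal (fun i => if i ∈ S then (1 : ℂ) else 0)).map C := by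
      ext i j
      rcases eq_or_ne i j with rfl | hij
      · by_cases h : i ∈ S <;> simp [h]
      · simp [hij]
    rw [h2, Matrix.mul_add, Matrix.add_mul, Matrix.mul_one, hU, Matrix.mul_smul, Matrix.smul_mul,
      ← map_C_mul, ← map_C_mul, projLoop_eq, spanProj]
  rw [h1, det_mul_comm, ← Matrix.mul_assoc, mul_eq_one_comm.1 hU, Matrix.one_mul, det_diagonal,
    rank_spanProj, Finset.prod_ite_mem]
  simp

/-! ### Words -/

/-- The complementary projection at the same pole. -/
def compl (p : BasicParam n) : BasicParam n :=
  ⟨(p.pole, 1 - p.proj), p.2.1, p.2.2.1.one_sub, fun h => p.2.2.2.2 (sub_eq_zero.1 h).symm,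
    fun h => p.2.2.2.1 (sub_eq_self.1 h)⟩

theorem pole_compl (p : BasicParam n) : p.compl.pole = p.pole := rfl

theorem compl_compl (p : BasicParam n) : p.compl.compl = p := by
  apply Subtype.ext
  exact Prod.ext rfl (sub_sub_cancel 1 p.proj)

theorem isStarProjection_proj (p : BasicParam n) : IsStarProjection p.proj := p.2.2.1

theorem loop_compl (p : BasicParam n) : p.compl.loop = p.loopI := by
  change (1 - (1 - p.proj)).map C + theta p.pole • (1 - p.proj).map C = _
  rw [sub_sub_cancel, add_comm]
  rfl

theorem loopI_eq (p : BasicParam n) : p.loopI = theta p.pole • (p.loop)ᴴ := by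
  rw [← loop_compl, loop_eq, loop_eq, conjTranspose_projLoop _ p.isStarProjection_proj,
    theta_smul_projLoop_star]
  rfl

theorem isLoop_loop (p : BasicParam n) : p.loop.IsLoop :=
  isLoop_projLoop p.2.1 p.isStarProjection_proj

theorem rank_proj_le (p : BasicParam n) : p.proj.rank ≤ n - 1 :=
  rank_le_pred_of_isStarProjection p.isStarProjection_proj p.2.2.2.2

/-- A nonzero entry of the projection would make `θ` itself regular at the pole; evaluating `(X - α)
* θ = X - star α` at `α` would then give `α = star α`. -/
theorem not_regularAt_loop (p : BasicParam n) : ¬ p.loop.RegularAt p.pole := by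
  intro h
  have hne : p.proj ≠ 0 := p.2.2.2.1
  have hex : ∃ a b, p.proj a b ≠ 0 := by
    by_contra hcon
    push Not at hcon
    exact hne (by ext a b; exact hcon a b)
  obtain ⟨a, b, hab⟩ := hex
  have h1 : theta p.pole * C (p.proj a b) ∈ regAt p.pole := by
    have := sub_mem (h a b) (C_mem_regAt ((1 - p.proj) a b) p.pole)
    have e : p.loop a b - C ((1 - p.proj) a b) = theta p.pole * C (p.proj a b) :=
      add_sub_cancel_left _ _
    rwa [e] at this
  have h2 : theta p.pole ∈ regAt p.pole := by
    have := mul_mem h1 (C_mem_regAt (p.proj a b)⁻¹ p.pole)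
    rwa [mul_assoc, ← map_mul, mul_inv_cancel₀ hab, map_one, mul_one] at this
  have h3 := eval_mul_of_mem (X_sub_C_mem_regAt p.pole p.pole) h2
  rw [X_sub_C_mul_theta, eval_X_sub_C, eval_X_sub_C, sub_self, zero_mul, sub_eq_zero] at h3
  exact p.2.1 (Complex.conj_eq_iff_im.1 h3.symm)

theorem word_nil : word ([] : List (BasicParam n)) = 1 := rfl

theorem word_cons (p : BasicParam n) (w : List (BasicParam n)) :
    word (p :: w) = p.loop * word w := by simp [word]

theorem word_append (w w' : List (BasicParam n)) : word (w ++ w') = word w * word w' := by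
  simp [word]

theorem isLoop_word (w : List (BasicParam n)) : (word w).IsLoop := by
  induction w with
  | nil => exact IsLoop.one
  | cons p w ih => rw [word_cons]; exact p.isLoop_loop.mul ih

theorem regularAt_word {w : List (BasicParam n)} (h : ∀ p ∈ w, p.pole ≠ z) :
    (word w).RegularAt z := by
  induction w with
  | nil => exact regularAt_one z
  | cons p w ih =>
    rw [word_cons]
    exact (regularAt_projLoop _ (h p (by simp)).symm).mul (ih fun q hq => h q (by simp [hq]))

theorem exists_pole_eq {w : List (BasicParam n)} (h : (word w).HasPole z) :
    ∃ p ∈ w, p.pole = z := by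
  by_contra hcon
  push Not at hcon
  exact hasPole_iff.1 h (regularAt_word hcon)

/-- The product of the factors `θ` of the letters of a word. -/
noncomputable def thetaProd (w : List (BasicParam n)) : RatFunc ℂ :=
  (w.map fun p => theta p.pole).prod

theorem wordI_eq_word (w : List (BasicParam n)) : wordI w = word (w.reverse.map compl) := by
  rw [wordI, word, List.map_map]
  congr 2
  funext p
  exact p.loop_compl.symm

/-- The scalars leave each letter by `loopI_eq`, and the adjoint accounts for the reversed order.
The result depends on the word only through its product and the multiset of its poles. -/
theorem wordI_eq (w : List (BasicParam n)) : wordI w = thetaProd w • (word w)ᴴ := by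
  induction w with
  | nil => simp [wordI, word, thetaProd]
  | cons p w ih =>
    have h1 : wordI (p :: w) = wordI w * p.loopI := by simp [wordI]
    rw [h1, ih, loopI_eq, word_cons, conjTranspose_mul, Matrix.smul_mul, Matrix.mul_smul,
      smul_smul, mul_comm]
    simp [thetaProd]

theorem wordI_map_compl (w : List (BasicParam n)) : wordI (w.reverse.map compl) = word w := by
  rw [wordI_eq_word, ← List.map_reverse, List.reverse_reverse, List.map_map]
  have : (compl ∘ compl : BasicParam n → BasicParam n) = id := funext compl_compl
  rw [this, List.map_id]

theorem thetaProd_eq_of_perm {w w' : List (BasicParam n)}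
    (h : (w.map pole).Perm (w'.map pole)) : thetaProd w = thetaProd w' := by
  have h1 : ∀ w : List (BasicParam n), thetaProd w = ((w.map pole).map theta).prod := fun w => by
    rw [thetaProd, List.map_map]; rfl
  rw [h1, h1]
  exact (h.map theta).prod_eq

end BasicParam

/-! ### The multiplicity of a pole -/

namespace MeroMatrix

open RatFunc Matrix BasicParam

variable {n : ℕ} {φ ψ χ : MeroMatrix n} {α β z : ℂ} {N : ℕ}

/-- The bounds on the pole at `α` of a product of basic loops of which `N` have their pole there. -/
structure MultBound (φ : MeroMatrix n) (α : ℂ) (N : ℕ) : Prop where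
  regularAt : RegularAt ((X - C α) ^ N • φ) α
  det_mem : (X - C α) ^ ((n - 1) * N) * φ.det ∈ regAt α

/-- The number of basic loops with pole at `α` that are needed to write `φ`. -/
noncomputable def mult (φ : MeroMatrix n) (α : ℂ) : ℕ := sInf {N | MultBound φ α N}

theorem mult_le (h : MultBound φ α N) : mult φ α ≤ N := Nat.sInf_le h

theorem exists_multBound (hn : 2 ≤ n) (φ : MeroMatrix n) (α : ℂ) : ∃ N, MultBound φ α N := by
  choose k hk using fun ab : Fin n × Fin n => exists_pow_mul_mem_regAt (φ ab.1 ab.2) α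
  obtain ⟨d, hd⟩ := exists_pow_mul_mem_regAt φ.det α
  have key : ∀ {f : RatFunc ℂ} {k N : ℕ}, (X - C α) ^ k * f ∈ regAt α → k ≤ N →
      (X - C α) ^ N * f ∈ regAt α := by
    intro f k N hf hkN
    obtain ⟨e, rfl⟩ := Nat.exists_eq_add_of_le' hkN
    rw [pow_add, mul_assoc]
    exact mul_mem (pow_mem (X_sub_C_mem_regAt _ _) _) hf
  refine ⟨(Finset.univ.sup k) + d, fun a b => ?_, ?_⟩
  · exact key (hk (a, b)) ((Finset.le_sup (f := k) (Finset.mem_univ (a, b))).trans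
      (Nat.le_add_right _ _))
  · refine key hd ?_
    -- Here `n ≥ 2` enters: the factor `n - 1` must be at least `1` for the determinant bound to be
    -- attainable.
    calc d ≤ 1 * (Finset.univ.sup k + d) := by omega
      _ ≤ _ := Nat.mul_le_mul_right _ (by omega)

theorem multBound_mult (hn : 2 ≤ n) (φ : MeroMatrix n) (α : ℂ) : MultBound φ α (mult φ α) :=
  Nat.sInf_mem (exists_multBound hn φ α)

theorem RegularAt.multBound_zero (h : φ.RegularAt α) : MultBound φ α 0 where
  regularAt := by simpa using h
  det_mem := by simpa using h.det

theorem RegularAt.mult_eq_zero (h : φ.RegularAt α) : mult φ α = 0 :=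
  Nat.le_zero.1 (mult_le h.multBound_zero)

theorem regularAt_of_mult_eq_zero (hn : 2 ≤ n) (h : mult φ α = 0) : φ.RegularAt α := by
  have := (multBound_mult hn φ α).regularAt
  rwa [h, pow_zero, one_smul] at this

theorem MultBound.mul_left (h : MultBound φ α N) (hψ : ψ.RegularAt α) :
    MultBound (ψ * φ) α N where
  regularAt := by rw [← Matrix.mul_smul]; exact hψ.mul h.regularAt
  det_mem := by rw [det_mul, mul_left_comm]; exact mul_mem hψ.det h.det_mem

theorem MultBound.mul_right (h : MultBound φ α N) (hψ : ψ.RegularAt α) :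
    MultBound (φ * ψ) α N where
  regularAt := by rw [← Matrix.smul_mul]; exact h.regularAt.mul hψ
  det_mem := by rw [det_mul, ← mul_assoc]; exact mul_mem h.det_mem hψ.det

/-- A factor invertible over the regular functions at `α` transports both bounds in either
direction. In applications the inverse is the adjoint. -/
theorem mult_mul_left (hψ : ψ.RegularAt α) (hχ : χ.RegularAt α) (h : χ * ψ = 1) :
    mult (ψ * φ) α = mult φ α := by
  rw [mult, mult]
  congr 1
  ext N
  refine ⟨fun hN => ?_, fun hN => MultBound.mul_left hN hψ⟩
  have := MultBound.mul_left hN hχ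
  rwa [← Matrix.mul_assoc, h, Matrix.one_mul] at this

theorem mult_mul_right (hψ : ψ.RegularAt α) (hχ : χ.RegularAt α) (h : ψ * χ = 1) :
    mult (φ * ψ) α = mult φ α := by
  rw [mult, mult]
  congr 1
  ext N
  refine ⟨fun hN => ?_, fun hN => MultBound.mul_right hN hψ⟩
  have := MultBound.mul_right hN hχ
  rwa [Matrix.mul_assoc, h, Matrix.mul_one] at this

/-- One more basic loop costs one order of the pole and, its rank being at most `n - 1`, at most `n
- 1` orders in the determinant. -/
theorem MultBound.loop_mul (p : BasicParam n) (h : MultBound φ p.pole N) :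
    MultBound (p.loop * φ) p.pole (N + 1) where
  regularAt := by
    have : (X - C p.pole) ^ (N + 1) • (p.loop * φ) =
        ((X - C p.pole) • p.loop) * ((X - C p.pole) ^ N • φ) := by
      rw [Matrix.smul_mul, Matrix.mul_smul, smul_smul, pow_succ']
    rw [this]
    exact (regularAt_X_sub_C_smul_projLoop _ _).mul h.regularAt
  det_mem := by
    obtain ⟨e, he⟩ := Nat.exists_eq_add_of_le' p.rank_proj_le
    have h1 : (X - C p.pole) ^ ((n - 1) * (N + 1)) * (p.loop * φ).det =
        (X - C p.pole) ^ e * ((X - C p.pole) * theta p.pole) ^ p.proj.rank *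
          ((X - C p.pole) ^ ((n - 1) * N) * φ.det) := by
      have h2 : (X - C p.pole) ^ (n - 1) = (X - C p.pole) ^ e * (X - C p.pole) ^ p.proj.rank := by
        rw [he, pow_add]
      rw [det_mul, loop_eq, det_projLoop _ p.isStarProjection_proj, mul_add, mul_one, pow_add, h2,
        mul_pow]
      ring
    rw [h1, X_sub_C_mul_theta]
    exact mul_mem (mul_mem (pow_mem (X_sub_C_mem_regAt _ _) _)
      (pow_mem (X_sub_C_mem_regAt _ _) _)) h.det_mem

/-! ### Counting the letters of a word by pole position. -/

open Classical in
/-- The number of letters of a word with pole at `α`. -/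
noncomputable def poleCount (w : List (BasicParam n)) (α : ℂ) : ℕ := (w.map pole).count α

theorem poleCount_nil (α : ℂ) : poleCount ([] : List (BasicParam n)) α = 0 := rfl

theorem poleCount_cons_self (p : BasicParam n) (w : List (BasicParam n)) :
    poleCount (p :: w) p.pole = poleCount w p.pole + 1 := by
  simp [poleCount]

theorem poleCount_cons_of_ne {p : BasicParam n} (w : List (BasicParam n)) (h : p.pole ≠ α) :
    poleCount (p :: w) α = poleCount w α := by
  simp [poleCount, h]

theorem poleCount_append (w w' : List (BasicParam n)) (α : ℂ) :
    poleCount (w ++ w') α = poleCount w α + poleCount w' α := by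
  simp [poleCount]

theorem poleCount_eq_zero_iff {w : List (BasicParam n)} :
    poleCount w α = 0 ↔ ∀ p ∈ w, p.pole ≠ α := by
  simp [poleCount, List.count_eq_zero]

theorem poleCount_eq_length {w : List (BasicParam n)} (h : ∀ p ∈ w, p.pole = α) :
    poleCount w α = w.length := by
  rw [poleCount, List.count_eq_length.2, List.length_map]
  intro b hb
  obtain ⟨p, hp, rfl⟩ := List.mem_map.1 hb
  exact (h p hp).symm

theorem multBound_word (w : List (BasicParam n)) (α : ℂ) :
    MultBound (word w) α (poleCount w α) := by
  induction w with
  | nil => exact (regularAt_one α).multBound_zero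
  | cons p w ih =>
    rw [word_cons]
    by_cases h : p.pole = α
    · subst h
      rw [poleCount_cons_self]
      exact MultBound.loop_mul p ih
    · rw [poleCount_cons_of_ne w h]
      exact ih.mul_left (regularAt_projLoop _ (Ne.symm h))

theorem mult_word_le (w : List (BasicParam n)) (α : ℂ) : mult (word w) α ≤ poleCount w α :=
  mult_le (multBound_word w α)

open Classical in
theorem length_eq_sum_poleCount {w : List (BasicParam n)} {A : Finset ℂ}
    (h : ∀ p ∈ w, p.pole ∈ A) : w.length = ∑ α ∈ A, poleCount w α := by
  have h1 := Multiset.sum_count_eq_card (s := A) (m := ((w.map pole : List ℂ) : Multiset ℂ))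
    (by
      intro a ha
      obtain ⟨p, hp, rfl⟩ := List.mem_map.1 (Multiset.mem_coe.1 ha)
      exact h p hp)
  simpa [poleCount] using h1.symm

theorem length_le_of_poleCount_le {w w' : List (BasicParam n)}
    (h : ∀ α, poleCount w α ≤ poleCount w' α) : w.length ≤ w'.length := by
  classical
  let A : Finset ℂ := (w.map pole).toFinset ∪ (w'.map pole).toFinset
  have hA : ∀ p ∈ w, p.pole ∈ A := fun p hp =>
    Finset.mem_union_left _ (List.mem_toFinset.2 (List.mem_map_of_mem hp))
  have hA' : ∀ p ∈ w', p.pole ∈ A := fun p hp =>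
    Finset.mem_union_right _ (List.mem_toFinset.2 (List.mem_map_of_mem hp))
  rw [length_eq_sum_poleCount hA, length_eq_sum_poleCount hA']
  exact Finset.sum_le_sum fun α _ => h α

/-- The length is the sum of the counts, so termwise inequalities with no gain in the total are
equalities. This is how minimality of the length becomes information at each pole. -/
theorem poleCount_eq_of_length_le {w w' : List (BasicParam n)}
    (h : ∀ α, poleCount w α ≤ poleCount w' α) (hl : w'.length ≤ w.length) (α : ℂ) :
    poleCount w α = poleCount w' α := by
  classical
  let A : Finset ℂ := insert α ((w.map pole).toFinset ∪ (w'.map pole).toFinset)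
  have hA : ∀ p ∈ w, p.pole ∈ A := fun p hp => Finset.mem_insert_of_mem
    (Finset.mem_union_left _ (List.mem_toFinset.2 (List.mem_map_of_mem hp)))
  have hA' : ∀ p ∈ w', p.pole ∈ A := fun p hp => Finset.mem_insert_of_mem
    (Finset.mem_union_right _ (List.mem_toFinset.2 (List.mem_map_of_mem hp)))
  rw [length_eq_sum_poleCount hA, length_eq_sum_poleCount hA'] at hl
  have h1 := (Finset.sum_eq_sum_iff_of_le (fun α _ => h α)).1
    (le_antisymm (Finset.sum_le_sum fun α _ => h α) hl)
  exact h1 α (Finset.mem_insert_self _ _)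

/-! ### Extraction of the poles at one point -/

/-- The product of the loops `P^⊥ + θ_α P` for the matrices of a list. -/
noncomputable def projWord (α : ℂ) (l : List (Matrix (Fin n) (Fin n) ℂ)) : MeroMatrix n :=
  (l.map (projLoop α)).prod

theorem projWord_cons (P : Matrix (Fin n) (Fin n) ℂ) (l : List (Matrix (Fin n) (Fin n) ℂ)) :
    projWord α (P :: l) = projLoop α P * projWord α l := by simp [projWord]

theorem projWord_append (l l' : List (Matrix (Fin n) (Fin n) ℂ)) :
    projWord α (l ++ l') = projWord α l * projWord α l' := by simp [projWord]

/-- A factor `P^⊥ + θ_α P` can be split off so that the order of the pole at `α` decreases. -/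
theorem IsLoop.exists_split (hφ : φ.IsLoop) (hα : α.im ≠ 0) (hc : φ.RegularAt (star α))
    (hN : RegularAt ((X - C α) ^ (N + 1) • φ) α) :
    ∃ (P : Matrix (Fin n) (Fin n) ℂ) (ψ : MeroMatrix n), IsStarProjection P ∧
      φ = projLoop α P * ψ ∧ ψ.IsLoop ∧ RegularAt ((X - C α) ^ N • ψ) α ∧
      ∀ z, z ≠ α → φ.RegularAt z → ψ.RegularAt z := by
  obtain ⟨P, hP, hPA, hPB⟩ := exists_rangeProj (value ((X - C α) ^ (N + 1) • φ) α)
  have hα' : star α ≠ α := fun h => hα (Complex.conj_eq_iff_im.1 h)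
  have hst : (star α).im ≠ 0 := by simpa using hα
  -- If `A` is the leading coefficient at `α`, unitarity makes `Aᴴ * φ(star α)` the value of `(X -
  -- star α) ^ (N + 1)` at `star α`, which is zero. So the range projection of `A` kills `φ(star
  -- α)`.
  have hA : P * φ.value (star α) = 0 := by
    apply hPB
    have h1 : RegularAt (((X - C α) ^ (N + 1) • φ)ᴴ : MeroMatrix n) (star α) :=
      regularAt_conjTranspose.2 (by rwa [star_star])
    rw [← value_conjTranspose hN, ← value_mul h1 hc, conjTranspose_smul, Matrix.smul_mul,
      hφ.conjTranspose_mul, star_pow, star_X_sub_C,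
      value_smul (pow_mem (X_sub_C_mem_regAt _ _) _) (regularAt_one _),
      eval_pow_of_mem (X_sub_C_mem_regAt _ _), eval_X_sub_C, sub_self,
      zero_pow (Nat.succ_ne_zero N), zero_smul]
  refine ⟨P, projLoop (star α) P * φ, hP, ?_, (isLoop_projLoop hst hP).mul hφ, ?_, ?_⟩
  · rw [← Matrix.mul_assoc, projLoop_mul_star α hP, Matrix.one_mul]
  · have e : (X - C α) ^ N • (projLoop (star α) P * φ) =
        (X - C α)⁻¹ • ((1 - P).map C * ((X - C α) ^ (N + 1) • φ)) +
          (X - C (star α))⁻¹ • (P.map C * ((X - C α) ^ (N + 1) • φ)) := by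
      have ht : theta (star α) = (X - C (star α))⁻¹ * (X - C α) := by
        have h3 := X_sub_C_mul_theta (star α)
        rw [star_star] at h3
        rw [← h3, inv_mul_cancel_left₀ (X_sub_C_ne_zero _)]
      have h0 := X_sub_C_ne_zero α
      rw [projLoop, Matrix.add_mul, smul_add, Matrix.mul_smul, Matrix.mul_smul, smul_smul,
        smul_smul, Matrix.smul_mul, smul_smul, ht, pow_succ']
      congr 2
      · rw [inv_mul_cancel_left₀ h0]
      · ring
    rw [e]
    -- The order drops because `(1 - P) * A = 0` cancels the inverse of `X - α`; on the range of
    -- `P`, the zero of `θ_{star α}` at `α` has already done so.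
    refine .add (RegularAt.inv_smul ((regularAt_map_C _ _).mul hN) ?_)
      (.smul (X_sub_C_inv_mem_regAt hα'.symm) ((regularAt_map_C _ _).mul hN))
    rw [value_mul (regularAt_map_C _ _) hN, value_map_C, Matrix.sub_mul, Matrix.one_mul, hPA,
      sub_self]
  · intro z hz hr
    -- The only possible new pole is that of `θ_{star α}`, and it is cancelled by `P * φ(star α) =
    -- 0`.
    by_cases hzc : z = star α
    · subst hzc
      have e : projLoop (star α) P * φ = (1 - P).map C * φ +
          (X - C α) • ((X - C (star α))⁻¹ • (P.map C * φ)) := by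
        have ht : theta (star α) = (X - C α) * (X - C (star α))⁻¹ := by
          have h3 := X_sub_C_mul_theta (star α)
          rw [star_star] at h3
          rw [← h3, mul_comm, inv_mul_cancel_left₀ (X_sub_C_ne_zero _)]
        rw [projLoop, Matrix.add_mul, Matrix.smul_mul, ht, smul_smul]
      rw [e]
      refine .add ((regularAt_map_C _ _).mul hr) (.smul (X_sub_C_mem_regAt _ _)
        (RegularAt.inv_smul ((regularAt_map_C _ _).mul hr) ?_))
      rw [value_mul (regularAt_map_C _ _) hr, value_map_C, hA]
    · exact (regularAt_projLoop P hzc).mul hr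

/-- Repeated splitting. The projections `0` and `1` are still allowed here, so this is not yet a
word of basic loops. -/
theorem IsLoop.exists_projWord (hφ : φ.IsLoop) (hα : α.im ≠ 0) (hc : φ.RegularAt (star α))
    (hN : RegularAt ((X - C α) ^ N • φ) α) :
    ∃ (l : List (Matrix (Fin n) (Fin n) ℂ)) (ψ : MeroMatrix n), (∀ P ∈ l, IsStarProjection P) ∧
      l.length = N ∧ φ = projWord α l * ψ ∧ ψ.IsLoop ∧ ψ.RegularAt α ∧
      ∀ z, z ≠ α → φ.RegularAt z → ψ.RegularAt z := by
  induction N generalizing φ with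
  | zero =>
    refine ⟨[], φ, by simp, rfl, by simp [projWord], hφ, by simpa using hN, fun z _ h => h⟩
  | succ N ih =>
    obtain ⟨P, ψ, hP, hφψ, hψ, hψN, hr⟩ := hφ.exists_split hα hc hN
    have hα' : star α ≠ α := fun h => hα (Complex.conj_eq_iff_im.1 h)
    obtain ⟨l, χ, hl, hlen, hψχ, hχ, hχα, hr'⟩ := ih hψ (hr _ hα' hc) hψN
    refine ⟨P :: l, χ, ?_, by simp [hlen], ?_, hχ, hχα, fun z hz h => hr' z hz (hr z hz h)⟩
    · intro Q hQ
      rcases List.mem_cons.1 hQ with rfl | hQ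
      · exact hP
      · exact hl Q hQ
    · rw [projWord_cons, Matrix.mul_assoc, ← hψχ, hφψ]

theorem det_projWord {l : List (Matrix (Fin n) (Fin n) ℂ)} (hl : ∀ P ∈ l, IsStarProjection P) :
    (projWord α l).det = theta α ^ (l.map rank).sum := by
  induction l with
  | nil => simp [projWord]
  | cons P l ih =>
    rw [projWord_cons, det_mul, det_projLoop α (hl P (by simp)),
      ih fun Q hQ => hl Q (by simp [hQ]), ← pow_add, List.map_cons, List.sum_cons]

/-- The scalar factors of a product of loops `P^⊥ + θ_α P`. -/
theorem exists_scalar_factor {l : List (Matrix (Fin n) (Fin n) ℂ)}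
    (hl : ∀ P ∈ l, IsStarProjection P) :
    ∃ (m : ℕ) (l' : List (Matrix (Fin n) (Fin n) ℂ)), (∀ P ∈ l', IsStarProjection P ∧ P ≠ 1) ∧
      l'.length + m = l.length ∧ (l'.map rank).sum + n * m = (l.map rank).sum ∧
      projWord α l = theta α ^ m • projWord α l' := by
  induction l with
  | nil => exact ⟨0, [], by simp, by simp, by simp, by simp [projWord]⟩
  | cons P l ih =>
    obtain ⟨m, l', h1, h2, h3, h4⟩ := ih fun Q hQ => hl Q (by simp [hQ])
    by_cases hP : P = 1
    · refine ⟨m + 1, l', h1, by simp [← h2, add_assoc], ?_, ?_⟩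
      · rw [List.map_cons, List.sum_cons, ← h3, hP, rank_one, Fintype.card_fin]
        ring
      · rw [projWord_cons, h4, hP, projLoop_one, Matrix.smul_mul, Matrix.one_mul, smul_smul,
          pow_succ']
    · refine ⟨m, P :: l', ?_, by simp [← h2]; ring, ?_, ?_⟩
      · intro Q hQ
        rcases List.mem_cons.1 hQ with rfl | hQ
        · exact ⟨hl Q (by simp), hP⟩
        · exact h1 Q hQ
      · rw [List.map_cons, List.sum_cons, List.map_cons, List.sum_cons, ← h3]
        ring
      · rw [projWord_cons, projWord_cons, h4, Matrix.mul_smul]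

/-- Scalar factors can be distributed over factors of smaller rank. -/
theorem exists_absorb_scalar (m : ℕ) {l : List (Matrix (Fin n) (Fin n) ℂ)}
    (hl : ∀ P ∈ l, IsStarProjection P ∧ P ≠ 1)
    (hm : (l.map rank).sum + m ≤ (n - 1) * l.length) :
    ∃ l' : List (Matrix (Fin n) (Fin n) ℂ), (∀ P ∈ l', IsStarProjection P ∧ P ≠ 1) ∧
      l'.length = l.length + m ∧ projWord α l' = theta α ^ m • projWord α l := by
  induction m generalizing l with
  | zero => exact ⟨l, hl, rfl, by simp⟩
  | succ m ih =>
    -- Pigeonhole: if all ranks were at least `n - 1`, their sum would leave no room for a further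
    -- scalar.
    obtain ⟨P, hPl, hPr⟩ : ∃ P ∈ l, P.rank < n - 1 := by
      by_contra hcon
      push Not at hcon
      have h1 : (l.map rank).length • (n - 1) ≤ (l.map rank).sum := by
        apply List.card_nsmul_le_sum
        intro r hr
        obtain ⟨P, hP, rfl⟩ := List.mem_map.1 hr
        exact hcon P hP
      rw [List.length_map, smul_eq_mul, mul_comm] at h1
      omega
    obtain ⟨hP, hP1⟩ := hl P hPl
    obtain ⟨E, hE, hPE, -, hPE', hr1, hr2⟩ := exists_rank_one_orthogonal hP hP1
    obtain ⟨l₁, l₂, rfl⟩ := List.append_of_mem hPl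
    have hne1 : P + E ≠ 1 := fun h => by
      rw [h, rank_one, Fintype.card_fin] at hr1
      omega
    have hne2 : 1 - E ≠ 1 := fun h => by
      rw [h, rank_one, Fintype.card_fin] at hr2
      omega
    -- Replacing `P` by the pair `P + E`, `1 - E` adds `n` to the sum of ranks and `n - 1` to its
    -- bound, which is just the one unit gained from the absorbed scalar.
    obtain ⟨l', h1, h2, h3⟩ := ih (l := l₁ ++ (P + E) :: (1 - E) :: l₂) (by
      intro Q hQ
      simp only [List.mem_append, List.mem_cons] at hQ
      rcases hQ with hQ | rfl | rfl | hQ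
      · exact hl Q (by simp [hQ])
      · exact ⟨hPE', hne1⟩
      · exact ⟨hE.one_sub, hne2⟩
      · exact hl Q (by simp [hQ])) (by
      simp only [List.map_append, List.map_cons, List.sum_append, List.sum_cons,
        List.length_append, List.length_cons, hr1, hr2] at hm ⊢
      rw [← add_assoc, mul_add] at hm ⊢
      rw [mul_add (n - 1) (l₂.length + 1) 1]
      omega)
    refine ⟨l', h1, ?_, ?_⟩
    · rw [h2]
      simp only [List.length_append, List.length_cons]
      ring
    · rw [h3, projWord_append, projWord_append, projWord_cons, projWord_cons, projWord_cons,
        ← Matrix.mul_assoc (projLoop α (P + E)), projLoop_add_mul α hE hPE, Matrix.smul_mul,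
        Matrix.mul_smul, smul_smul, pow_succ]

theorem exists_word_eq_projWord (hα : α.im ≠ 0) {l : List (Matrix (Fin n) (Fin n) ℂ)}
    (hl : ∀ P ∈ l, IsStarProjection P ∧ P ≠ 1) :
    ∃ w : List (BasicParam n), (∀ p ∈ w, p.pole = α) ∧ w.length ≤ l.length ∧
      word w = projWord α l := by
  induction l with
  | nil => exact ⟨[], by simp, le_rfl, rfl⟩
  | cons P l ih =>
    obtain ⟨w, h1, h2, h3⟩ := ih fun Q hQ => hl Q (by simp [hQ])
    by_cases hP : P = 0
    · exact ⟨w, h1, by simpa using h2.trans (Nat.le_succ _), by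
        rw [projWord_cons, hP, projLoop_zero, Matrix.one_mul, h3]⟩
    · obtain ⟨hP', hP1⟩ := hl P (by simp)
      refine ⟨⟨(α, P), hα, hP', hP, hP1⟩ :: w, ?_, by simpa using h2, ?_⟩
      · intro p hp
        rcases List.mem_cons.1 hp with rfl | hp
        · rfl
        · exact h1 p hp
      · rw [word_cons, projWord_cons, h3]
        rfl

/-- The pole of `θ` at `α` is genuinely of order one, since its numerator does not vanish at `α`;
with `d > K` one could recover `(X - α)⁻¹` as a regular function. -/
theorem le_of_pow_mul_theta_mem (hα : α.im ≠ 0) {d K : ℕ}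
    (h : (X - C α) ^ K * theta α ^ d ∈ regAt α) : d ≤ K := by
  by_contra hlt
  obtain ⟨e, rfl⟩ := Nat.exists_eq_add_of_lt (not_le.1 hlt)
  have hα' : α ≠ star α := fun h => hα (Complex.conj_eq_iff_im.1 h.symm)
  have h0 := X_sub_C_ne_zero α
  apply X_sub_C_inv_not_mem_regAt α
  have h1 : (X - C α)⁻¹ = (X - C α) ^ e * ((X - C α) ^ K * theta α ^ (K + e + 1)) *
      ((X - C (star α))⁻¹) ^ (K + e + 1) := by
    rw [← X_sub_C_mul_theta, mul_inv, mul_pow, inv_pow, inv_pow]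
    have ht := theta_ne_zero α
    field_simp
    ring
  rw [h1]
  exact mul_mem (mul_mem (pow_mem (X_sub_C_mem_regAt _ _) _) h)
    (pow_mem (X_sub_C_inv_mem_regAt hα') _)

/-- All the poles at `α` can be split off with `mult φ α` basic loops. -/
theorem IsLoop.exists_extract (hn : 2 ≤ n) (hφ : φ.IsLoop) (hα : α.im ≠ 0)
    (hc : φ.RegularAt (star α)) :
    ∃ (w : List (BasicParam n)) (ψ : MeroMatrix n), φ = word w * ψ ∧ (∀ p ∈ w, p.pole = α) ∧
      w.length ≤ mult φ α ∧ ψ.IsLoop ∧ ψ.RegularAt α ∧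
      ∀ z, φ.RegularAt z → ψ.RegularAt z := by
  obtain ⟨hN, hdet⟩ := multBound_mult hn φ α
  obtain ⟨l, ψ, hl, hlen, hφψ, hψ, hψα, hr⟩ := hφ.exists_projWord hα hc hN
  have hα' : star α ≠ α := fun h => hα (Complex.conj_eq_iff_im.1 h)
  -- The determinant of the remainder is invertible at `α`, so the pole of `det φ` there is that of
  -- `θ` raised to the sum of the ranks.
  have hd : (l.map rank).sum ≤ (n - 1) * mult φ α := by
    apply le_of_pow_mul_theta_mem hα
    have h1 : RegularAt (ψᴴ : MeroMatrix n) α := regularAt_conjTranspose.2 (hr _ hα' hc)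
    have h2 := mul_mem hdet h1.det
    have h3 : ψ.det * (ψᴴ).det = 1 := by rw [← det_mul, hψ.mul_conjTranspose, det_one]
    rwa [hφψ, det_mul, det_projWord hl, ← hφψ, mul_assoc, mul_assoc, h3, mul_one] at h2
  obtain ⟨m, l₀, h1, h2, h3, h4⟩ := exists_scalar_factor (α := α) hl
  obtain ⟨l', h5, h6, h7⟩ := exists_absorb_scalar (α := α) m h1 (by
    rw [← hlen, ← h2, ← h3, mul_add] at hd
    -- Each removed scalar accounted for rank `n` but only one letter, so the bound on the remaining
    -- projections keeps one spare unit for each of the `m` scalars.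
    have hnm : n * m = (n - 1) * m + m := by
      obtain ⟨k, rfl⟩ := Nat.exists_eq_add_of_le' hn
      simp only [show k + 2 - 1 = k + 1 by omega]
      ring
    omega)
  obtain ⟨w, h8, h9, h10⟩ := exists_word_eq_projWord hα h5
  refine ⟨w, ψ, by rw [h10, h7, ← h4, hφψ], h8, by omega, hψ, hψα, fun z hz => ?_⟩
  by_cases hza : z = α
  · rw [hza]; exact hψα
  · exact hr z hza hz

/-! ### Factorisation of loops -/

/-- A loop with no poles at conjugate positions. -/
structure IsGenericLoop (φ : MeroMatrix n) : Prop where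
  isLoop : φ.IsLoop
  regularAt_or : ∀ z, φ.RegularAt z ∨ φ.RegularAt (star z)

/-- Poles can be removed one position at a time because extraction at `α` leaves the multiplicity
elsewhere unchanged and creates no new poles. -/
theorem IsGenericLoop.exists_extract_finset (hn : 2 ≤ n) (A : Finset ℂ)
    (hA : ∀ α ∈ A, α.im ≠ 0) (hφ : φ.IsGenericLoop) :
    ∃ (w : List (BasicParam n)) (ψ : MeroMatrix n), φ = word w * ψ ∧ (∀ p ∈ w, p.pole ∈ A) ∧
      (∀ β, poleCount w β + mult ψ β ≤ mult φ β) ∧ ψ.IsGenericLoop ∧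
      (∀ z, φ.RegularAt z → ψ.RegularAt z) ∧ ∀ α ∈ A, ψ.RegularAt α := by
  classical
  induction A using Finset.induction_on generalizing φ with
  | empty =>
    exact ⟨[], φ, by rw [word_nil, Matrix.one_mul], by simp, fun β => by simp [poleCount_nil], hφ,
      fun z h => h, by simp⟩
  | insert α A _ ih =>
    have hα : α.im ≠ 0 := hA α (by simp)
    have hα' : star α ≠ α := fun h => hα (Complex.conj_eq_iff_im.1 h)
    have hA' : ∀ β ∈ A, β.im ≠ 0 := fun β hβ => hA β (by simp [hβ])
    rcases hφ.regularAt_or α with hr | hr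
    · obtain ⟨w, ψ, h1, h2, h3, h4, h5, h6⟩ := ih hA' hφ
      refine ⟨w, ψ, h1, fun p hp => by simp [h2 p hp], h3, h4, h5, fun β hβ => ?_⟩
      rcases Finset.mem_insert.1 hβ with rfl | hβ
      · exact h5 _ hr
      · exact h6 β hβ
    · obtain ⟨w, ψ, h1, h2, h3, h4, h5, h6⟩ := hφ.isLoop.exists_extract hn hα hr
      have hψ : ψ.IsGenericLoop := ⟨h4, fun z => (hφ.regularAt_or z).imp (h6 _) (h6 _)⟩
      obtain ⟨w', χ, k1, k2, k3, k4, k5, k6⟩ := ih hA' hψ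
      have hcount : ∀ β, poleCount w β + mult ψ β ≤ mult φ β := by
        intro β
        by_cases hβ : β = α
        · rw [hβ, h5.mult_eq_zero, poleCount_eq_length h2]
          exact h3
        · have hw0 : poleCount w β = 0 := poleCount_eq_zero_iff.2 fun p hp => by
            rw [h2 p hp]; exact Ne.symm hβ
          -- At `star α` the extracted word is not invertible, so invariance of `mult` is
          -- unavailable; but `φ`, and with it the remainder, is regular there. At all other points
          -- the word is a unit.
          by_cases hβ' : β = star α
          · rw [hw0, hβ', (h6 _ hr).mult_eq_zero]
            exact Nat.zero_le _
          · have hw1 : (word w).RegularAt β := regularAt_word (poleCount_eq_zero_iff.1 hw0)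
            have hw2 : RegularAt ((word w)ᴴ : MeroMatrix n) β :=
              regularAt_conjTranspose.2 (regularAt_word fun p hp => by
                rw [h2 p hp]
                intro h
                exact hβ' (by rw [h, star_star]))
            rw [hw0, zero_add, h1, mult_mul_left hw1 hw2 (isLoop_word w).conjTranspose_mul]
      refine ⟨w ++ w', χ, ?_, ?_, ?_, k4, fun z hz => k5 z (h6 z hz), ?_⟩
      · rw [word_append, Matrix.mul_assoc, ← k1, h1]
      · intro p hp
        rcases List.mem_append.1 hp with hp | hp
        · simp [h2 p hp]
        · simp [k2 p hp]
      · intro β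
        rw [poleCount_append, add_assoc]
        exact (Nat.add_le_add_left (k3 β) _).trans (hcount β)
      · intro β hβ
        rcases Finset.mem_insert.1 hβ with rfl | hβ
        · exact k5 _ h5
        · exact k6 β hβ

/-- Every loop without conjugate poles is a product of basic loops with poles in the lower half
plane and of basic loops with poles in the upper half plane, with the least possible number of
factors. -/
theorem IsGenericLoop.exists_words (hn : 2 ≤ n) (hφ : φ.IsGenericLoop) :
    ∃ w₁ w₂ : List (BasicParam n), (∀ p ∈ w₁, p.pole.im < 0) ∧ (∀ p ∈ w₂, 0 < p.pole.im) ∧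
      φ = word w₁ * word w₂ ∧ ∀ α, poleCount (w₁ ++ w₂) α = mult φ α := by
  classical
  let A : Finset ℂ := (finite_setOf_hasPole φ).toFinset
  obtain ⟨w₁, ψ, h1, h2, h3, h4, h5, h6⟩ := hφ.exists_extract_finset hn
    (A.filter fun z => z.im < 0) (fun α hα => ((Finset.mem_filter.1 hα).2).ne)
  obtain ⟨w₂, χ, k1, k2, k3, k4, k5, k6⟩ := h4.exists_extract_finset hn
    (A.filter fun z => 0 < z.im) (fun α hα => ((Finset.mem_filter.1 hα).2).ne')
  -- All poles have been removed, so Liouville applies to the remainder.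
  have hχ : χ = 1 := by
    refine k4.isLoop.eq_one fun z => ?_
    by_cases hz : φ.RegularAt z
    · exact k5 z (h5 z hz)
    · have hzA : z ∈ A := by simpa [A] using hasPole_iff.2 hz
      rcases lt_trichotomy z.im 0 with h | h | h
      · exact k5 z (h6 z (Finset.mem_filter.2 ⟨hzA, h⟩))
      · exact absurd (regularAt_of_im_eq_zero hφ.isLoop h) hz
      · exact k6 z (Finset.mem_filter.2 ⟨hzA, h⟩)
  rw [hχ, Matrix.mul_one] at k1
  have hw : φ = word w₁ * word w₂ := by rw [h1, k1]
  refine ⟨w₁, w₂, fun p hp => (Finset.mem_filter.1 (h2 p hp)).2,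
    fun p hp => (Finset.mem_filter.1 (k2 p hp)).2, hw, fun α => le_antisymm ?_ ?_⟩
  · rw [poleCount_append]
    have a1 := h3 α
    have a2 := k3 α
    omega
  · rw [hw, ← word_append]
    exact mult_word_le _ _

end MeroMatrix

/-! ### The involution -/

namespace MeroMatrix

open RatFunc Matrix BasicParam

variable {n : ℕ} {φ ψ : MeroMatrix n} {α z : ℂ} {w : List (BasicParam n)}

theorem IsGenericLoop.exists_word (hn : 2 ≤ n) (hφ : φ.IsGenericLoop) :
    ∃ w : List (BasicParam n), word w = φ ∧ ∀ α, poleCount w α = mult φ α := by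
  obtain ⟨w₁, w₂, -, -, h, hc⟩ := hφ.exists_words hn
  exact ⟨w₁ ++ w₂, by rw [word_append, h], hc⟩

theorem isMinWord_of_poleCount (hw : word w = φ) (hc : ∀ α, poleCount w α = mult φ α) :
    IsMinWord φ w :=
  ⟨hw, fun w' hw' => length_le_of_poleCount_le fun α => by
    rw [hc, ← hw']; exact mult_word_le _ _⟩

/-- Every word has at least `mult φ α` letters at each `α`, and some word attains all these bounds
at once; a word of minimal length must therefore attain each of them. -/
theorem IsGenericLoop.poleCount_eq_mult (hn : 2 ≤ n) (hφ : φ.IsGenericLoop)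
    (hw : IsMinWord φ w) (α : ℂ) : poleCount w α = mult φ α := by
  obtain ⟨w₀, h0, hc⟩ := hφ.exists_word hn
  rw [← hc]
  refine (poleCount_eq_of_length_le (fun β => ?_) (hw.2 w₀ h0) α).symm
  rw [hc, ← hw.1]
  exact mult_word_le _ _

theorem thetaProd_eq_of_poleCount {w w' : List (BasicParam n)}
    (h : ∀ α, poleCount w α = poleCount w' α) : thetaProd w = thetaProd w' := by
  classical
  apply thetaProd_eq_of_perm
  rw [List.perm_iff_count]
  intro α
  have := h α
  rw [poleCount, poleCount] at this
  convert! this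

/-- Two minimal words have the same product and the same poles with multiplicity, so the scalar and
the adjoint in `wordI_eq` agree. -/
theorem IsGenericLoop.eq_wordI (hn : 2 ≤ n) (hφ : φ.IsGenericLoop) (hw : word w = φ)
    (hc : ∀ α, poleCount w α = mult φ α) (h : IsI φ ψ) : ψ = wordI w := by
  obtain ⟨w', hw', rfl⟩ := h
  rw [wordI_eq, wordI_eq, hw'.1, hw, thetaProd_eq_of_poleCount (w := w') (w' := w) fun α =>
    (hφ.poleCount_eq_mult hn hw' α).trans (hc α).symm]

theorem IsGenericLoop.existsUnique_isI (hn : 2 ≤ n) (hφ : φ.IsGenericLoop) : ∃! ψ, IsI φ ψ := by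
  obtain ⟨w, hw, hc⟩ := hφ.exists_word hn
  exact ⟨wordI w, ⟨w, isMinWord_of_poleCount hw hc, rfl⟩, fun ψ h => hφ.eq_wordI hn hw hc h⟩

theorem IsGenericLoop.iOp_eq (hn : 2 ≤ n) (hφ : φ.IsGenericLoop) (hw : word w = φ)
    (hc : ∀ α, poleCount w α = mult φ α) : iOp φ = wordI w := by
  have h : ∃ ψ, IsI φ ψ := (hφ.existsUnique_isI hn).exists
  rw [iOp, dif_pos h]
  exact hφ.eq_wordI hn hw hc h.choose_spec

/-- Loops with the same pole multiplicities have the same scalar factor in the involution. -/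
theorem IsGenericLoop.exists_iOp_eq_smul (hn : 2 ≤ n) (hφ : φ.IsGenericLoop)
    (hψ : ψ.IsGenericLoop) (h : ∀ α, mult φ α = mult ψ α) :
    ∃ f : RatFunc ℂ, iOp φ = f • φᴴ ∧ iOp ψ = f • ψᴴ := by
  obtain ⟨w, hw, hc⟩ := hφ.exists_word hn
  obtain ⟨w', hw', hc'⟩ := hψ.exists_word hn
  refine ⟨thetaProd w, ?_, ?_⟩
  · rw [hφ.iOp_eq hn hw hc, wordI_eq, hw]
  · rw [hψ.iOp_eq hn hw' hc', wordI_eq, hw', thetaProd_eq_of_poleCount fun α => by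
      rw [hc, hc', h]]

theorem IsGenericLoop.regularAt_iOp (hn : 2 ≤ n) (hφ : φ.IsGenericLoop) (hz : φ.RegularAt z) :
    (iOp φ).RegularAt z := by
  obtain ⟨w, hw, hc⟩ := hφ.exists_word hn
  rw [hφ.iOp_eq hn hw hc, wordI_eq_word]
  apply regularAt_word
  intro p hp
  obtain ⟨q, hq, rfl⟩ := List.mem_map.1 hp
  rw [pole_compl]
  exact poleCount_eq_zero_iff.1 ((hc z).trans hz.mult_eq_zero) q (List.mem_reverse.1 hq)

theorem IsGenericLoop.isLoop_iOp (hn : 2 ≤ n) (hφ : φ.IsGenericLoop) : (iOp φ).IsLoop := by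
  obtain ⟨w, hw, hc⟩ := hφ.exists_word hn
  rw [hφ.iOp_eq hn hw hc, wordI_eq_word]
  exact isLoop_word _

/-! ### Loops that are regular in a half plane -/

/-- A set of points that contains one of any two conjugate points off the real axis. -/
structure IsHalfPlane (H : Set ℂ) : Prop where
  mem_or : ∀ z : ℂ, z.im ≠ 0 → z ∈ H ∨ star z ∈ H

theorem isHalfPlane_upper : IsHalfPlane {z : ℂ | 0 < z.im} where
  mem_or z hz := by
    rcases lt_or_gt_of_ne hz with h | h
    · exact Or.inr (by simpa using h)
    · exact Or.inl h

theorem isHalfPlane_lower : IsHalfPlane {z : ℂ | z.im < 0} where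
  mem_or z hz := by
    rcases lt_or_gt_of_ne hz with h | h
    · exact Or.inl h
    · exact Or.inr (by simpa using h)

/-- The loops that are regular at all points of `H`. -/
def loopsOn (n : ℕ) (H : Set ℂ) : Set (MeroMatrix n) := {φ | φ.IsLoop ∧ ∀ z ∈ H, φ.RegularAt z}

/-- The scalar loops that are regular at all points of `H`. -/
def scalarLoopsOn (n : ℕ) (H : Set ℂ) : Set (MeroMatrix n) :=
  {φ | φ ∈ loopsOn n H ∧ ∃ f : RatFunc ℂ, φ = f • (1 : MeroMatrix n)}

theorem loopG_eq : loopG n = loopsOn n {z : ℂ | 0 < z.im} := Set.ext fun _ => mem_loopG_iff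

theorem loopM_eq : loopM n = loopsOn n {z : ℂ | z.im < 0} := Set.ext fun _ => mem_loopM_iff

theorem loopJG_eq : loopJG n = scalarLoopsOn n {z : ℂ | 0 < z.im} := by
  rw [loopJG, loopG_eq]; rfl

theorem loopJM_eq : loopJM n = scalarLoopsOn n {z : ℂ | z.im < 0} := by
  rw [loopJM, loopM_eq]; rfl

variable {H : Set ℂ}

theorem isGenericLoop_of_mem (hH : IsHalfPlane H) (hφ : φ ∈ loopsOn n H) : φ.IsGenericLoop where
  isLoop := hφ.1
  regularAt_or z := by
    by_cases hz : z.im = 0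
    · exact Or.inl (regularAt_of_im_eq_zero hφ.1 hz)
    · exact (hH.mem_or z hz).imp (hφ.2 _) (hφ.2 _)

theorem mul_mem_loopsOn (hφ : φ ∈ loopsOn n H) (hψ : ψ ∈ loopsOn n H) : φ * ψ ∈ loopsOn n H :=
  ⟨hφ.1.mul hψ.1, fun z hz => (hφ.2 z hz).mul (hψ.2 z hz)⟩

theorem iOp_mem_loopsOn (hn : 2 ≤ n) (hH : IsHalfPlane H) (hφ : φ ∈ loopsOn n H) :
    iOp φ ∈ loopsOn n H :=
  ⟨(isGenericLoop_of_mem hH hφ).isLoop_iOp hn,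
    fun z hz => (isGenericLoop_of_mem hH hφ).regularAt_iOp hn (hφ.2 z hz)⟩

theorem word_mem_loopsOn (hw : ∀ p ∈ w, p.pole ∉ H) : word w ∈ loopsOn n H :=
  ⟨isLoop_word w, fun _ hz => regularAt_word fun p hp h => hw p hp (h ▸ hz)⟩

theorem pole_not_mem_of_mem (hφ : φ ∈ loopsOn n H) (hc : ∀ α, poleCount w α = mult φ α) :
    ∀ p ∈ w, p.pole ∉ H := by
  intro p hp hpH
  exact poleCount_eq_zero_iff.1 ((hc _).trans (hφ.2 _ hpH).mult_eq_zero) p hp rfl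

/-- A loop in `loopsOn n H` is invertible at its regular points outside of `H`. -/
theorem regularAt_or_of_mem (hH : IsHalfPlane H) (hφ : φ ∈ loopsOn n H) (z : ℂ) :
    z ∈ H ∨ φ.RegularAt (star z) := by
  by_cases hz : z.im = 0
  · exact Or.inr (regularAt_of_im_eq_zero hφ.1 (by simpa using hz))
  · exact (hH.mem_or z hz).imp id (hφ.2 _)

/-- Outside `H` the adjoints of both loops are regular, so whichever loop is regular at `z` is a
unit there and can be stripped off. -/
theorem mult_mul_of_regularAt_or (hH : IsHalfPlane H) (hφ : φ ∈ loopsOn n H)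
    (hψ : ψ ∈ loopsOn n H) (h : φ.RegularAt z ∨ ψ.RegularAt z) :
    mult (φ * ψ) z = mult φ z + mult ψ z := by
  by_cases hz : z ∈ H
  · rw [((hφ.2 z hz).mul (hψ.2 z hz)).mult_eq_zero, (hφ.2 z hz).mult_eq_zero,
      (hψ.2 z hz).mult_eq_zero]
  · have h1 := regularAt_conjTranspose.2 ((regularAt_or_of_mem hH hφ z).resolve_left hz)
    have h2 := regularAt_conjTranspose.2 ((regularAt_or_of_mem hH hψ z).resolve_left hz)
    rcases h with h | h
    · rw [mult_mul_left h h1 hφ.1.conjTranspose_mul, h.mult_eq_zero, zero_add]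
    · rw [mult_mul_right h h2 hψ.1.mul_conjTranspose, h.mult_eq_zero, add_zero]

theorem wordI_append (w w' : List (BasicParam n)) : wordI (w ++ w') = wordI w' * wordI w := by
  simp [wordI]

/-- Without common poles the multiplicities add, so concatenating minimal words gives a minimal word
of the product. -/
theorem iOp_mul (hn : 2 ≤ n) (hH : IsHalfPlane H) (hφ : φ ∈ loopsOn n H) (hψ : ψ ∈ loopsOn n H)
    (h : NoCommonPoles φ ψ) : iOp (φ * ψ) = iOp ψ * iOp φ := by
  have gφ := isGenericLoop_of_mem hH hφ
  have gψ := isGenericLoop_of_mem hH hψ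
  obtain ⟨w, hw, hc⟩ := gφ.exists_word hn
  obtain ⟨w', hw', hc'⟩ := gψ.exists_word hn
  rw [(isGenericLoop_of_mem hH (mul_mem_loopsOn hφ hψ)).iOp_eq hn (w := w ++ w')
    (by rw [word_append, hw, hw']) fun α => by
      rw [poleCount_append, hc, hc', mult_mul_of_regularAt_or hH hφ hψ]
      by_contra hcon
      push Not at hcon
      exact h α (hasPole_iff.2 hcon.1) (hasPole_iff.2 hcon.2),
    gφ.iOp_eq hn hw hc, gψ.iOp_eq hn hw' hc', wordI_append]

/-! ### Simple loops -/

/-- At the pole of one letter all the other letters are units, because their poles and the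
conjugates of these lie elsewhere. If the whole word were regular there, so would be that single
letter. -/
theorem poleCount_eq_mult_of_pairwise (hn : 2 ≤ n)
    (hw : w.Pairwise (fun p q => p.pole ≠ q.pole ∧ p.pole ≠ starRingEnd ℂ q.pole)) (α : ℂ) :
    poleCount w α = mult (word w) α := by
  refine le_antisymm ?_ (mult_word_le w α)
  by_cases h0 : poleCount w α = 0
  · rw [h0]; exact Nat.zero_le _
  rw [poleCount_eq_zero_iff] at h0
  push Not at h0
  obtain ⟨p, hp, rfl⟩ := h0
  obtain ⟨w₁, w₂, rfl⟩ := List.append_of_mem hp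
  obtain ⟨-, hw2, hw3⟩ := List.pairwise_append.1 hw
  have hw4 := (List.pairwise_cons.1 hw2).1
  have h1 : ∀ q ∈ w₁, q.pole ≠ p.pole ∧ q.pole ≠ star p.pole := fun q hq => hw3 q hq p (by simp)
  have h2 : ∀ q ∈ w₂, q.pole ≠ p.pole ∧ q.pole ≠ star p.pole := fun q hq =>
    ⟨(hw4 q hq).1.symm, fun h => (hw4 q hq).2 (by
      change p.pole = star q.pole
      rw [h, star_star])⟩
  have e1 : poleCount (w₁ ++ p :: w₂) p.pole = 1 := by
    rw [poleCount_append, poleCount_cons_self,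
      poleCount_eq_zero_iff.2 fun q hq => (h1 q hq).1,
      poleCount_eq_zero_iff.2 fun q hq => (h2 q hq).1]
  rw [e1, Nat.one_le_iff_ne_zero]
  intro hm
  have hr := regularAt_of_mult_eq_zero hn hm
  have r1 : RegularAt ((word w₁)ᴴ : MeroMatrix n) p.pole :=
    regularAt_conjTranspose.2 (regularAt_word fun q hq => (h1 q hq).2)
  have r2 : RegularAt ((word w₂)ᴴ : MeroMatrix n) p.pole :=
    regularAt_conjTranspose.2 (regularAt_word fun q hq => (h2 q hq).2)
  apply p.not_regularAt_loop
  have e2 : p.loop = (word w₁)ᴴ * word (w₁ ++ p :: w₂) * (word w₂)ᴴ := by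
    rw [word_append, word_cons, ← Matrix.mul_assoc, (isLoop_word w₁).conjTranspose_mul,
      Matrix.one_mul, Matrix.mul_assoc, (isLoop_word w₂).mul_conjTranspose, Matrix.mul_one]
  rw [e2]
  exact (r1.mul hr).mul r2

theorem pairwise_reverse_compl
    (hw : w.Pairwise (fun p q => p.pole ≠ q.pole ∧ p.pole ≠ starRingEnd ℂ q.pole)) :
    (w.reverse.map compl).Pairwise
      (fun p q => p.pole ≠ q.pole ∧ p.pole ≠ starRingEnd ℂ q.pole) := by
  rw [List.pairwise_map, List.pairwise_reverse]
  refine hw.imp fun {p q} h => ⟨h.1.symm, fun h' => h.2 ?_⟩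
  rw [pole_compl, pole_compl] at h'
  rw [h', Complex.conj_conj]

theorem iOp_word_of_pairwise (hn : 2 ≤ n) (hH : IsHalfPlane H) (hm : word w ∈ loopsOn n H)
    (hw : w.Pairwise (fun p q => p.pole ≠ q.pole ∧ p.pole ≠ starRingEnd ℂ q.pole)) :
    iOp (word w) = wordI w :=
  (isGenericLoop_of_mem hH hm).iOp_eq hn rfl (poleCount_eq_mult_of_pairwise hn hw)

theorem iOp_mem_simpleLoops (hn : 2 ≤ n) (hH : IsHalfPlane H)
    (hφ : φ ∈ loopsOn n H ∩ simpleLoops n) : iOp φ ∈ loopsOn n H ∩ simpleLoops n := by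
  refine ⟨iOp_mem_loopsOn hn hH hφ.1, ?_⟩
  obtain ⟨hm, w, hw, rfl⟩ := hφ
  exact ⟨_, pairwise_reverse_compl hw, by
    rw [iOp_word_of_pairwise hn hH hm hw, wordI_eq_word]⟩

theorem iOp_iOp_of_simple (hn : 2 ≤ n) (hH : IsHalfPlane H)
    (hφ : φ ∈ loopsOn n H ∩ simpleLoops n) : iOp (iOp φ) = φ := by
  have hi := iOp_mem_loopsOn hn hH hφ.1
  obtain ⟨hm, w, hw, rfl⟩ := hφ
  have h1 := iOp_word_of_pairwise hn hH hm hw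
  rw [h1, wordI_eq_word] at hi ⊢
  rw [iOp_word_of_pairwise hn hH hi (pairwise_reverse_compl hw), wordI_map_compl]

/-! ### Almost groups of loops -/

/-- The laws of an almost group of loops that do not depend on the involutivity. -/
theorem isAlmostGroupOn_of (hn : 2 ≤ n) (hH : IsHalfPlane H) {S : Set (MeroMatrix n)}
    {R : MeroMatrix n → MeroMatrix n → Prop}
    (hmaps : ∀ g ∈ loopsOn n H ∩ S, iOp g ∈ loopsOn n H ∩ S)
    (hii : ∀ g ∈ loopsOn n H ∩ S, iOp (iOp g) = g)
    (hmul : ∀ g ∈ loopsOn n H, ∀ h ∈ loopsOn n H, R g h → iOp (g * h) = iOp h * iOp g) :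
    IsAlmostGroupOn (loopsOn n H) (scalarLoopsOn n H) iOp S R where
  mul_mem _ hg _ hh := mul_mem_loopsOn hg hh
  i_mem _ hg := iOp_mem_loopsOn hn hH hg
  i_bijOn := Set.InvOn.bijOn ⟨hii, hii⟩ hmaps hmaps
  J_subset _ hj := hj.1
  J_mul_mem := by
    rintro j ⟨hj, f, rfl⟩ k ⟨hk, g, rfl⟩
    exact ⟨mul_mem_loopsOn hj hk, f * g, by
      rw [Matrix.smul_mul, Matrix.mul_smul, Matrix.one_mul, smul_smul]⟩
  J_i_mem := by
    rintro j ⟨hj, f, rfl⟩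
    refine ⟨iOp_mem_loopsOn hn hH hj, ?_⟩
    have hg := isGenericLoop_of_mem hH hj
    obtain ⟨t, ht, -⟩ := hg.exists_iOp_eq_smul hn hg fun _ => rfl
    exact ⟨t * star f, by rw [ht, conjTranspose_smul, conjTranspose_one, smul_smul]⟩
  i_mul := hmul
  J_central := by
    rintro g - j ⟨-, f, rfl⟩
    rw [Matrix.smul_mul, Matrix.mul_smul, Matrix.one_mul, Matrix.mul_one]
  mul_i_comm g hg := by
    have hg' := isGenericLoop_of_mem hH hg
    obtain ⟨t, ht, -⟩ := hg'.exists_iOp_eq_smul hn hg' fun _ => rfl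
    rw [ht, Matrix.smul_mul, Matrix.mul_smul, hg.1.mul_conjTranspose, hg.1.conjTranspose_mul]
  mul_i_mem g hg := by
    refine ⟨mul_mem_loopsOn hg (iOp_mem_loopsOn hn hH hg), ?_⟩
    have hg' := isGenericLoop_of_mem hH hg
    obtain ⟨t, ht, -⟩ := hg'.exists_iOp_eq_smul hn hg' fun _ => rfl
    exact ⟨t, by rw [ht, Matrix.mul_smul, hg.1.mul_conjTranspose]⟩
  i_i := hii

theorem isAlmostGroupOn_loopsOn (hn : 2 ≤ n) (hH : IsHalfPlane H) :
    IsAlmostGroupOn (loopsOn n H) (scalarLoopsOn n H) iOp (simpleLoops n) NoCommonPoles :=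
  isAlmostGroupOn_of hn hH (fun _ hg => iOp_mem_simpleLoops hn hH hg)
    (fun _ hg => iOp_iOp_of_simple hn hH hg) fun _ hg _ hh h => iOp_mul hn hH hg hh h

/-! ### Two by two loops -/

theorem det_loop_two (p : BasicParam 2) : p.loop.det = theta p.pole := by
  have h1 := p.rank_proj_le
  have h2 : p.proj.rank ≠ 0 := fun h =>
    p.2.2.2.1 (eq_zero_of_rank_eq_zero_of_isStarProjection p.isStarProjection_proj h)
  have h3 : p.proj.rank = 1 := by omega
  rw [loop_eq, det_projLoop _ p.isStarProjection_proj, h3, pow_one]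

theorem det_word_two (w : List (BasicParam 2)) : (word w).det = thetaProd w := by
  induction w with
  | nil => simp [word, thetaProd]
  | cons p w ih => rw [word_cons, det_mul, ih, det_loop_two]; simp [thetaProd]

/-- In dimension two all projections have rank one, so the product of the `θ` is the determinant,
and `det φ • φᴴ` is the adjugate. It reverses products and is an involution on all `2 × 2` matrices.
-/
theorem iOp_eq_adjugate {H : Set ℂ} (hH : IsHalfPlane H) {φ : MeroMatrix 2}
    (hφ : φ ∈ loopsOn 2 H) : iOp φ = φ.adjugate := by
  have hg := isGenericLoop_of_mem hH hφ
  obtain ⟨w, hw, hc⟩ := hg.exists_word le_rfl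
  rw [hg.iOp_eq le_rfl hw hc, wordI_eq, ← det_word_two, hw]
  calc φ.det • φᴴ = φ.adjugate * φ * φᴴ := by rw [adjugate_mul, Matrix.smul_mul, Matrix.one_mul]
    _ = φ.adjugate := by rw [Matrix.mul_assoc, hφ.1.mul_conjTranspose, Matrix.mul_one]

theorem isAlmostGroup_two {H : Set ℂ} (hH : IsHalfPlane H) :
    IsAlmostGroup (loopsOn 2 H) (scalarLoopsOn 2 H) iOp := by
  refine isAlmostGroupOn_of le_rfl hH (fun g hg => ⟨iOp_mem_loopsOn le_rfl hH hg.1, trivial⟩)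
    (fun g hg => ?_) (fun g hg h hh _ => ?_)
  · rw [iOp_eq_adjugate hH (iOp_mem_loopsOn le_rfl hH hg.1), iOp_eq_adjugate hH hg.1,
      adjugate_adjugate _ (by simp)]
    simp
  · rw [iOp_eq_adjugate hH (mul_mem_loopsOn hg hh), iOp_eq_adjugate hH hg, iOp_eq_adjugate hH hh,
      adjugate_mul_distrib]

end MeroMatrix

/-! ### The actions -/

namespace MeroMatrix

open RatFunc Matrix BasicParam

variable {n : ℕ} {s t u v s' u' : MeroMatrix n} {z : ℂ}

theorem noConjPoles_iff : NoConjPoles s u ↔ ∀ z, s.RegularAt z ∨ u.RegularAt (star z) := by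
  refine forall_congr' fun z => ?_
  rw [hasPole_iff, hasPole_iff, not_not]
  exact Classical.or_iff_not_imp_left.symm

theorem isGenericLoop_of_mem_loopG (hu : u ∈ loopG n) : u.IsGenericLoop :=
  isGenericLoop_of_mem isHalfPlane_upper (loopG_eq ▸ hu)

theorem isGenericLoop_of_mem_loopM (hs : s ∈ loopM n) : s.IsGenericLoop :=
  isGenericLoop_of_mem isHalfPlane_lower (loopM_eq ▸ hs)

theorem regularAt_of_mem_loopG (hu : u ∈ loopG n) (hz : 0 ≤ z.im) : u.RegularAt z := by
  rw [mem_loopG_iff] at hu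
  rcases hz.lt_or_eq with h | h
  · exact hu.2 z h
  · exact regularAt_of_im_eq_zero hu.1 h.symm

theorem regularAt_of_mem_loopM (hs : s ∈ loopM n) (hz : z.im ≤ 0) : s.RegularAt z := by
  rw [mem_loopM_iff] at hs
  rcases hz.lt_or_eq with h | h
  · exact hs.2 z h
  · exact regularAt_of_im_eq_zero hs.1 h

theorem mul_mem_loopG (hu : u ∈ loopG n) (hv : v ∈ loopG n) : u * v ∈ loopG n := by
  rw [loopG_eq] at *
  exact mul_mem_loopsOn hu hv

theorem mul_mem_loopM (hs : s ∈ loopM n) (ht : t ∈ loopM n) : s * t ∈ loopM n := by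
  rw [loopM_eq] at *
  exact mul_mem_loopsOn hs ht

theorem conjTranspose_regularAt_of_mem_loopG (hu : u ∈ loopG n) (hz : z.im ≤ 0) :
    RegularAt (uᴴ : MeroMatrix n) z :=
  regularAt_conjTranspose.2 (regularAt_of_mem_loopG hu (by simpa using hz))

theorem conjTranspose_regularAt_of_mem_loopM (hs : s ∈ loopM n) (hz : 0 ≤ z.im) :
    RegularAt (sᴴ : MeroMatrix n) z :=
  regularAt_conjTranspose.2 (regularAt_of_mem_loopM hs (by simpa using hz))

/-- Poles of the product come from `s` above the axis and from `u` below it, and admissibility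
forbids a conjugate pair among them. -/
theorem isGenericLoop_mul (hs : s ∈ loopM n) (hu : u ∈ loopG n) (h : NoConjPoles s u) :
    IsGenericLoop (s * u) where
  isLoop := (mem_loopM_iff.1 hs).1.mul (mem_loopG_iff.1 hu).1
  regularAt_or z := by
    rw [noConjPoles_iff] at h
    rcases le_total z.im 0 with hz | hz
    · have hz' : 0 ≤ (star z).im := by simpa using hz
      rcases h (star z) with h1 | h1
      · exact Or.inr (h1.mul (regularAt_of_mem_loopG hu hz'))
      · rw [star_star] at h1
        exact Or.inl ((regularAt_of_mem_loopM hs hz).mul h1)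
    · have hz' : (star z).im ≤ 0 := by simpa using hz
      rcases h z with h1 | h1
      · exact Or.inl (h1.mul (regularAt_of_mem_loopG hu hz))
      · exact Or.inr ((regularAt_of_mem_loopM hs hz').mul h1)

/-- The factorisation into a loop of `G` and a loop of `M` without conjugate poles is unique. -/
theorem eq_of_mul_eq_mul (hu : u ∈ loopG n) (hu' : u' ∈ loopG n) (hs : s ∈ loopM n)
    (hs' : s' ∈ loopM n) (h : u * s = u' * s') (hD : NoConjPoles s u) (hD' : NoConjPoles s' u') :
    u = u' ∧ s = s' := by
  have lu := (mem_loopG_iff.1 hu).1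
  have lu' := (mem_loopG_iff.1 hu').1
  have ls := (mem_loopM_iff.1 hs).1
  have ls' := (mem_loopM_iff.1 hs').1
  rw [noConjPoles_iff] at hD hD'
  have e : u'ᴴ * u = s' * sᴴ := by
    calc u'ᴴ * u = u'ᴴ * (u * s) * sᴴ := by
          rw [Matrix.mul_assoc, Matrix.mul_assoc, ls.mul_conjTranspose, Matrix.mul_one]
      _ = s' * sᴴ := by rw [h, ← Matrix.mul_assoc, lu'.conjTranspose_mul, Matrix.one_mul]
  have h1 : u'ᴴ * u = 1 := by
    -- Both expressions in `e` describe the same loop. At each point the absence of conjugate poles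
    -- makes one of them regular, using `hD` below the axis and `hD'` above it.
    refine (lu'.conjTranspose.mul lu).eq_one fun z => ?_
    rcases le_total z.im 0 with hz | hz
    · rcases hD (star z) with hr | hr
      · rw [e]
        exact (regularAt_of_mem_loopM hs' hz).mul (regularAt_conjTranspose.2 hr)
      · rw [star_star] at hr
        exact (conjTranspose_regularAt_of_mem_loopG hu' hz).mul hr
    · rcases hD' z with hr | hr
      · rw [e]
        exact hr.mul (conjTranspose_regularAt_of_mem_loopM hs hz)
      · exact (regularAt_conjTranspose.2 hr).mul (regularAt_of_mem_loopG hu hz)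
  refine ⟨?_, ?_⟩
  · calc u = u' * u'ᴴ * u := by rw [lu'.mul_conjTranspose, Matrix.one_mul]
      _ = u' := by rw [Matrix.mul_assoc, h1, Matrix.mul_one]
  · calc s = s' * sᴴ * s := by rw [← e, h1, Matrix.one_mul]
      _ = s' := by rw [Matrix.mul_assoc, ls.conjTranspose_mul, Matrix.mul_one]

theorem exists_isMinRefactor (hn : 2 ≤ n) (hs : s ∈ loopM n) (hu : u ∈ loopG n)
    (h : NoConjPoles s u) : ∃ p, IsMinRefactor s u p := by
  obtain ⟨w₁, w₂, h1, h2, h3, h4⟩ := (isGenericLoop_mul hs hu h).exists_words hn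
  refine ⟨(word w₁, word w₂), _, ⟨?_, ?_, h3, w₁, w₂, rfl, rfl, rfl⟩, ?_⟩
  · rw [loopG_eq]
    exact word_mem_loopsOn fun p hp => (h1 p hp).not_gt
  · rw [loopM_eq]
    exact word_mem_loopsOn fun p hp => (h2 p hp).not_gt
  · rintro q N' ⟨-, -, hq, v₁, v₂, hv1, hv2, rfl⟩
    rw [← List.length_append, ← List.length_append]
    apply length_le_of_poleCount_le
    intro α
    rw [h4, hq, ← hv1, ← hv2, ← word_append]
    exact mult_word_le _ _

/-- Compared with the words of `exists_words`, minimal total length forces the letters at each point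
to number exactly `mult (s * u)`. So the factors have poles only where `s * u` does, and never at
both of two conjugate points. -/
theorem noConjPoles_of_isMinRefactor (hn : 2 ≤ n) (hs : s ∈ loopM n) (hu : u ∈ loopG n)
    (h : NoConjPoles s u) {p : MeroMatrix n × MeroMatrix n} (hp : IsMinRefactor s u p) :
    NoConjPoles p.2 p.1 := by
  have hg := isGenericLoop_mul hs hu h
  obtain ⟨N, ⟨-, -, hsu, v₁, v₂, hv1, hv2, rfl⟩, hmin⟩ := hp
  obtain ⟨w₁, w₂, h1, h2, h3, h4⟩ := hg.exists_words hn
  have hlen := hmin (word w₁, word w₂) _ ⟨by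
    rw [loopG_eq]
    exact word_mem_loopsOn fun p hp => (h1 p hp).not_gt, by
    rw [loopM_eq]
    exact word_mem_loopsOn fun p hp => (h2 p hp).not_gt, h3, w₁, w₂, rfl, rfl, rfl⟩
  rw [← List.length_append, ← List.length_append] at hlen
  have hc : ∀ α, mult (s * u) α = poleCount v₁ α + poleCount v₂ α := by
    intro α
    rw [← h4, ← poleCount_append]
    refine poleCount_eq_of_length_le (fun β => ?_) hlen α
    rw [h4, hsu, ← hv1, ← hv2, ← word_append]
    exact mult_word_le _ _
  rw [noConjPoles_iff, ← hv1, ← hv2]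
  intro z
  have key : ∀ α, RegularAt (s * u) α → poleCount v₁ α = 0 ∧ poleCount v₂ α = 0 := by
    intro α hα
    have := hc α
    rw [hα.mult_eq_zero] at this
    omega
  rcases hg.regularAt_or z with hz | hz
  · exact Or.inl (regularAt_word (poleCount_eq_zero_iff.1 (key z hz).2))
  · exact Or.inr (regularAt_word (poleCount_eq_zero_iff.1 (key _ hz).1))

theorem existsUnique_isMinRefactor (hn : 2 ≤ n) (hs : s ∈ loopM n) (hu : u ∈ loopG n)
    (h : NoConjPoles s u) : ∃! p, IsMinRefactor s u p := by
  obtain ⟨p, hp⟩ := exists_isMinRefactor hn hs hu h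
  refine ⟨p, hp, fun q hq => ?_⟩
  have dp := noConjPoles_of_isMinRefactor hn hs hu h hp
  have dq := noConjPoles_of_isMinRefactor hn hs hu h hq
  obtain ⟨_, ⟨p1, p2, p3, -⟩, -⟩ := hp
  obtain ⟨_, ⟨q1, q2, q3, -⟩, -⟩ := hq
  obtain ⟨e1, e2⟩ := eq_of_mul_eq_mul q1 p1 q2 p2 (q3.symm.trans p3) dq dp
  exact Prod.ext e1 e2

/-- The properties that determine `s ▷ u` and `s ◁ u`. -/
structure IsAction (s u u' s' : MeroMatrix n) : Prop where
  left_mem : u' ∈ loopG n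
  right_mem : s' ∈ loopM n
  mul_eq : s * u = u' * s'
  noConjPoles : NoConjPoles s' u'

theorem isAction_act (hn : 2 ≤ n) (hs : s ∈ loopM n) (hu : u ∈ loopG n) (h : NoConjPoles s u) :
    IsAction s u (lAct s u) (rAct s u) := by
  have hex : ∃ p, IsMinRefactor s u p := exists_isMinRefactor hn hs hu h
  have hp : IsMinRefactor s u (refactor s u) := by
    rw [refactor, dif_pos hex]
    exact hex.choose_spec
  have hd := noConjPoles_of_isMinRefactor hn hs hu h hp
  obtain ⟨_, ⟨p1, p2, p3, -⟩, -⟩ := hp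
  exact ⟨p1, p2, p3, hd⟩

/-- Replaces minimality by conditions that can be checked directly; the matched pair laws are
obtained through this lemma. -/
theorem IsAction.act_eq (hn : 2 ≤ n) (hs : s ∈ loopM n) (hu : u ∈ loopG n)
    (h : NoConjPoles s u) (ha : IsAction s u u' s') : lAct s u = u' ∧ rAct s u = s' := by
  have hb := isAction_act hn hs hu h
  exact eq_of_mul_eq_mul hb.left_mem ha.left_mem hb.right_mem ha.right_mem
    (hb.mul_eq.symm.trans ha.mul_eq) hb.noConjPoles ha.noConjPoles

/-- Below the axis, either `u'` is regular by the absence of conjugate poles, or `s'ᴴ` is, and then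
`u' = s * u * s'ᴴ` has only regular factors. Hence the actions create no poles and preserve
admissibility. -/
theorem IsAction.regularAt_left (ha : IsAction s u u' s') (hs : s ∈ loopM n)
    (hz : u.RegularAt z) : u'.RegularAt z := by
  rcases le_total z.im 0 with h | h
  · rcases noConjPoles_iff.1 ha.noConjPoles (star z) with hr | hr
    · have e : u' = s * u * s'ᴴ := by
        rw [ha.mul_eq, Matrix.mul_assoc, (mem_loopM_iff.1 ha.right_mem).1.mul_conjTranspose,
          Matrix.mul_one]
      rw [e]
      exact ((regularAt_of_mem_loopM hs h).mul hz).mul (regularAt_conjTranspose.2 hr)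
    · rwa [star_star] at hr
  · exact regularAt_of_mem_loopG ha.left_mem h

theorem IsAction.regularAt_right (ha : IsAction s u u' s') (hu : u ∈ loopG n)
    (hz : s.RegularAt z) : s'.RegularAt z := by
  rcases le_total z.im 0 with h | h
  · exact regularAt_of_mem_loopM ha.right_mem h
  · rcases noConjPoles_iff.1 ha.noConjPoles z with hr | hr
    · exact hr
    · have e : s' = u'ᴴ * (s * u) := by
        rw [ha.mul_eq, ← Matrix.mul_assoc, (mem_loopG_iff.1 ha.left_mem).1.conjTranspose_mul,
          Matrix.one_mul]
      rw [e]
      exact (regularAt_conjTranspose.2 hr).mul (hz.mul (regularAt_of_mem_loopG hu h))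

/-- At a pole of `u` both `s` and `s'` are units, so `s * u = u' * s'` has there the multiplicity of
`u` and that of `u'`. -/
theorem IsAction.mult_left (ha : IsAction s u u' s') (hs : s ∈ loopM n) (hu : u ∈ loopG n)
    (hD : NoConjPoles s u) (z : ℂ) : mult u z = mult u' z := by
  have ls := (mem_loopM_iff.1 hs).1
  have ls' := (mem_loopM_iff.1 ha.right_mem).1
  by_cases hz : u.RegularAt z
  · rw [hz.mult_eq_zero, (ha.regularAt_left hs hz).mult_eq_zero]
  have him : z.im ≤ 0 := not_lt.1 fun h => hz (regularAt_of_mem_loopG hu h.le)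
  have h1 : s.RegularAt (star z) := by
    refine (noConjPoles_iff.1 hD (star z)).resolve_right ?_
    rwa [star_star]
  have h2 := ha.regularAt_right hu h1
  rw [← mult_mul_left (φ := u) (regularAt_of_mem_loopM hs him) (regularAt_conjTranspose.2 h1)
    ls.conjTranspose_mul, ha.mul_eq, mult_mul_right (regularAt_of_mem_loopM ha.right_mem him)
    (regularAt_conjTranspose.2 h2) ls'.mul_conjTranspose]

theorem IsAction.mult_right (ha : IsAction s u u' s') (hs : s ∈ loopM n) (hu : u ∈ loopG n)
    (hD : NoConjPoles s u) (z : ℂ) : mult s z = mult s' z := by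
  have lu := (mem_loopG_iff.1 hu).1
  have lu' := (mem_loopG_iff.1 ha.left_mem).1
  by_cases hz : s.RegularAt z
  · rw [hz.mult_eq_zero, (ha.regularAt_right hu hz).mult_eq_zero]
  have him : 0 ≤ z.im := not_lt.1 fun h => hz (regularAt_of_mem_loopM hs h.le)
  have h1 : u.RegularAt (star z) := (noConjPoles_iff.1 hD z).resolve_left hz
  have h2 := ha.regularAt_left hs h1
  rw [← mult_mul_right (φ := s) (regularAt_of_mem_loopG hu him) (regularAt_conjTranspose.2 h1)
    lu.mul_conjTranspose, ha.mul_eq, mult_mul_left (regularAt_of_mem_loopG ha.left_mem him)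
    (regularAt_conjTranspose.2 h2) lu'.conjTranspose_mul]

theorem noConjPoles_mono (h : NoConjPoles s u) (hs : ∀ z, s.RegularAt z → s'.RegularAt z)
    (hu : ∀ z, u.RegularAt z → u'.RegularAt z) : NoConjPoles s' u' :=
  noConjPoles_iff.2 fun z => (noConjPoles_iff.1 h z).imp (hs _) (hu _)

theorem noConjPoles_mul_left (hs : NoConjPoles s u) (ht : NoConjPoles t u) :
    NoConjPoles (s * t) u := by
  rw [noConjPoles_iff] at *
  intro z
  rcases hs z with h1 | h1
  · exact (ht z).imp h1.mul id
  · exact Or.inr h1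

theorem noConjPoles_mul_right (hu : NoConjPoles s u) (hv : NoConjPoles s v) :
    NoConjPoles s (u * v) := by
  rw [noConjPoles_iff] at *
  intro z
  rcases hu z with h1 | h1
  · exact Or.inl h1
  · exact (hv z).imp id h1.mul

theorem iOp_mem_loopG (hn : 2 ≤ n) (hu : u ∈ loopG n) : iOp u ∈ loopG n := by
  rw [loopG_eq] at *
  exact iOp_mem_loopsOn hn isHalfPlane_upper hu

theorem iOp_mem_loopM (hn : 2 ≤ n) (hs : s ∈ loopM n) : iOp s ∈ loopM n := by
  rw [loopM_eq] at *
  exact iOp_mem_loopsOn hn isHalfPlane_lower hs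

theorem noConjPoles_iOp (hn : 2 ≤ n) (hs : s ∈ loopM n) (hu : u ∈ loopG n)
    (h : NoConjPoles s u) : NoConjPoles (iOp s) (iOp u) :=
  noConjPoles_mono h (fun _ => (isGenericLoop_of_mem_loopM hs).regularAt_iOp hn)
    (fun _ => (isGenericLoop_of_mem_loopG hu).regularAt_iOp hn)

theorem IsAction.mul_right {u₁ s₁ v₁ s₂ : MeroMatrix n} (ha : IsAction s u u₁ s₁)
    (hb : IsAction s₁ v v₁ s₂) (hv : v ∈ loopG n) : IsAction s (u * v) (u₁ * v₁) s₂ where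
  left_mem := mul_mem_loopG ha.left_mem hb.left_mem
  right_mem := hb.right_mem
  mul_eq := by
    rw [← Matrix.mul_assoc, ha.mul_eq, Matrix.mul_assoc, hb.mul_eq, Matrix.mul_assoc]
  noConjPoles := noConjPoles_mul_right
    (noConjPoles_mono ha.noConjPoles (fun _ => hb.regularAt_right hv) fun _ h => h) hb.noConjPoles

theorem IsAction.mul_left {u₁ t₁ u₂ s₁ : MeroMatrix n} (ha : IsAction t u u₁ t₁)
    (hb : IsAction s u₁ u₂ s₁) (hs : s ∈ loopM n) : IsAction (s * t) u u₂ (s₁ * t₁) where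
  left_mem := hb.left_mem
  right_mem := mul_mem_loopM hb.right_mem ha.right_mem
  mul_eq := by
    rw [Matrix.mul_assoc, ha.mul_eq, ← Matrix.mul_assoc, hb.mul_eq, Matrix.mul_assoc]
  noConjPoles := noConjPoles_mul_left hb.noConjPoles
    (noConjPoles_mono ha.noConjPoles (fun _ h => h) fun _ => hb.regularAt_left hs)

/-- The actions preserve multiplicities, so `u`, `u'` share one scalar in the involution and `s`,
`s'` another. Up to these scalars the claim is the adjoint of `s * u = u' * s'`. -/
theorem IsAction.iOp (hn : 2 ≤ n) (ha : IsAction s u u' s') (hs : s ∈ loopM n)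
    (hu : u ∈ loopG n) (hD : NoConjPoles s u) :
    IsAction (iOp s') (iOp u') (iOp u) (iOp s) where
  left_mem := iOp_mem_loopG hn hu
  right_mem := iOp_mem_loopM hn hs
  mul_eq := by
    obtain ⟨f, f1, f2⟩ := (isGenericLoop_of_mem_loopG hu).exists_iOp_eq_smul hn
      (isGenericLoop_of_mem_loopG ha.left_mem) (ha.mult_left hs hu hD)
    obtain ⟨g, g1, g2⟩ := (isGenericLoop_of_mem_loopM hs).exists_iOp_eq_smul hn
      (isGenericLoop_of_mem_loopM ha.right_mem) (ha.mult_right hs hu hD)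
    rw [f1, f2, g1, g2, Matrix.smul_mul, Matrix.mul_smul, Matrix.smul_mul, Matrix.mul_smul,
      ← conjTranspose_mul, ← conjTranspose_mul, ha.mul_eq, smul_comm]
  noConjPoles := noConjPoles_iOp hn hs hu hD

theorem isMatchedPairOn_loops (hn : 2 ≤ n) :
    IsMatchedPairOn (loopG n) (loopJG n) (loopM n) (loopJM n) iOp lAct rAct NoConjPoles := by
  have act : ∀ {s u : MeroMatrix n}, s ∈ loopM n → u ∈ loopG n → NoConjPoles s u →
    IsAction s u (lAct s u) (rAct s u) := fun hs hu h => isAction_act hn hs hu h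
  have domL : ∀ s ∈ loopM n, ∀ t ∈ loopM n, ∀ u ∈ loopG n, NoConjPoles s u → NoConjPoles t u →
      NoConjPoles s (lAct t u) := fun s _ t ht u hu h1 h2 =>
    noConjPoles_mono h1 (fun _ h => h) fun _ => (act ht hu h2).regularAt_left ht
  have domR : ∀ s ∈ loopM n, ∀ u ∈ loopG n, ∀ v ∈ loopG n, NoConjPoles s u → NoConjPoles s v →
      NoConjPoles (rAct s u) v := fun s hs u hu v _ h1 h2 =>
    noConjPoles_mono h2 (fun _ => (act hs hu h1).regularAt_right hu) fun _ h => h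
  have mulR : ∀ s ∈ loopM n, ∀ u ∈ loopG n, ∀ v ∈ loopG n, NoConjPoles s u → NoConjPoles s v →
      lAct s (u * v) = lAct s u * lAct (rAct s u) v ∧ rAct s (u * v) = rAct (rAct s u) v :=
    fun s hs u hu v hv h1 h2 =>
      ((act hs hu h1).mul_right (act (act hs hu h1).right_mem hv (domR s hs u hu v hv h1 h2))
        hv).act_eq hn hs (mul_mem_loopG hu hv) (noConjPoles_mul_right h1 h2)
  have mulL : ∀ s ∈ loopM n, ∀ t ∈ loopM n, ∀ u ∈ loopG n, NoConjPoles s u → NoConjPoles t u →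
      lAct (s * t) u = lAct s (lAct t u) ∧ rAct (s * t) u = rAct s (lAct t u) * rAct t u :=
    fun s hs t ht u hu h1 h2 =>
      ((act ht hu h2).mul_left (act hs (act ht hu h2).left_mem (domL s hs t ht u hu h1 h2))
        hs).act_eq hn (mul_mem_loopM hs ht) hu (noConjPoles_mul_left h1 h2)
  have domI : ∀ s ∈ loopM n, ∀ u ∈ loopG n, NoConjPoles s u →
      NoConjPoles (iOp (rAct s u)) (iOp (lAct s u)) := fun s hs u hu h =>
    noConjPoles_iOp hn (act hs hu h).right_mem (act hs hu h).left_mem (act hs hu h).noConjPoles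
  have actI : ∀ s ∈ loopM n, ∀ u ∈ loopG n, NoConjPoles s u →
      lAct (iOp (rAct s u)) (iOp (lAct s u)) = iOp u ∧
        rAct (iOp (rAct s u)) (iOp (lAct s u)) = iOp s := fun s hs u hu h =>
    ((act hs hu h).iOp hn hs hu h).act_eq hn (iOp_mem_loopM hn (act hs hu h).right_mem)
      (iOp_mem_loopG hn (act hs hu h).left_mem) (domI s hs u hu h)
  have actJM : ∀ j ∈ loopJM n, ∀ u ∈ loopG n, NoConjPoles j u → lAct j u = u ∧ rAct j u = j := by
    rintro j ⟨hj, f, hf⟩ u hu h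
    refine IsAction.act_eq hn hj hu h ⟨hu, hj, ?_, h⟩
    rw [hf, Matrix.smul_mul, Matrix.mul_smul, Matrix.one_mul, Matrix.mul_one]
  have actJG : ∀ s ∈ loopM n, ∀ j ∈ loopJG n, NoConjPoles s j → lAct s j = j ∧ rAct s j = s := by
    rintro s hs j ⟨hj, f, hf⟩ h
    refine IsAction.act_eq hn hs hj h ⟨hj, hs, ?_, h⟩
    rw [hf, Matrix.smul_mul, Matrix.mul_smul, Matrix.one_mul, Matrix.mul_one]
  exact
    { l_mem := fun s hs u hu h => (act hs hu h).left_mem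
      r_mem := fun s hs u hu h => (act hs hu h).right_mem
      dom_mul_left := fun s _ t _ u _ h1 h2 => noConjPoles_mul_left h1 h2
      dom_mul_right := fun s _ u _ v _ h1 h2 => noConjPoles_mul_right h1 h2
      dom_l := domL
      dom_r := domR
      dom_i := domI
      r_mul := fun s hs u hu v hv h1 h2 => (mulR s hs u hu v hv h1 h2).2
      mul_r := fun s hs t ht u hu h1 h2 => (mulL s hs t ht u hu h1 h2).2
      mul_l := fun s hs t ht u hu h1 h2 => (mulL s hs t ht u hu h1 h2).1
      l_mul := fun s hs u hu v hv h1 h2 => (mulR s hs u hu v hv h1 h2).1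
      l_i := fun s hs u hu h => (actI s hs u hu h).1
      r_i := fun s hs u hu h => (actI s hs u hu h).2
      J_l := fun j hj u hu h => (actJM j hj u hu h).1
      J_r := fun j hj u hu h => (actJM j hj u hu h).2
      l_J := fun s hs j hj h => (actJG s hs j hj h).1
      r_J := fun s hs j hj h => (actJG s hs j hj h).2 }

/-! ### Generic parameters -/

theorem mem_loopM_iff_upperLoop (hn : 2 ≤ n) :
    s ∈ loopM n ↔ ∃ k, ∃ x : Fin k → UpperParam n, s = upperLoop x := by
  constructor
  · intro hs
    obtain ⟨w, hw, hc⟩ := (isGenericLoop_of_mem_loopM hs).exists_word hn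
    have hp := pole_not_mem_of_mem (loopM_eq ▸ hs) hc
    have hp' : ∀ p ∈ w, 0 < p.pole.im := fun p hpw =>
      lt_of_le_of_ne (not_lt.1 (hp p hpw)) (Ne.symm p.2.1)
    refine ⟨w.length, fun a => ⟨w.get a, hp' _ (w.get_mem a)⟩, ?_⟩
    rw [upperLoop, List.ofFn_get, hw]
  · rintro ⟨k, x, rfl⟩
    rw [loopM_eq]
    refine word_mem_loopsOn fun p hp => ?_
    obtain ⟨a, rfl⟩ := (List.mem_ofFn' _ _).1 hp
    exact (x a).2.not_gt

theorem mem_loopG_iff_lowerLoop (hn : 2 ≤ n) :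
    u ∈ loopG n ↔ ∃ k, ∃ y : Fin k → LowerParam n, u = lowerLoop y := by
  constructor
  · intro hu
    obtain ⟨w, hw, hc⟩ := (isGenericLoop_of_mem_loopG hu).exists_word hn
    have hp := pole_not_mem_of_mem (loopG_eq ▸ hu) hc
    have hp' : ∀ p ∈ w, p.pole.im < 0 := fun p hpw =>
      lt_of_le_of_ne (not_lt.1 (hp p hpw)) p.2.1
    refine ⟨w.length, fun a => ⟨w.get a, hp' _ (w.get_mem a)⟩, ?_⟩
    rw [lowerLoop, List.ofFn_get, hw]
  · rintro ⟨k, y, rfl⟩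
    rw [loopG_eq]
    refine word_mem_loopsOn fun p hp => ?_
    obtain ⟨a, rfl⟩ := (List.mem_ofFn' _ _).1 hp
    exact (y a).2.not_gt

theorem continuous_pole : Continuous (pole : BasicParam n → ℂ) :=
  continuous_fst.comp continuous_subtype_val

theorem isOpen_genericParams (n k m : ℕ) : IsOpen (genericParams n k m) := by
  have h1 : ∀ a, Continuous fun q : (Fin k → UpperParam n) × (Fin m → LowerParam n) =>
      (q.1 a).1.pole := fun a =>
    continuous_pole.comp (continuous_subtype_val.comp ((continuous_apply a).comp continuous_fst))
  have h2 : ∀ a, Continuous fun q : (Fin k → UpperParam n) × (Fin m → LowerParam n) =>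
      (q.2 a).1.pole := fun a =>
    continuous_pole.comp (continuous_subtype_val.comp ((continuous_apply a).comp continuous_snd))
  simp only [genericParams, Set.ofPred_and, Set.ofPred_forall]
  refine .inter ?_ (.inter ?_ ?_)
  · exact isOpen_iInter_of_finite fun a => isOpen_iInter_of_finite fun b =>
      isOpen_iInter_of_finite fun _ => isOpen_ne_fun (h1 a) (h1 b)
  · exact isOpen_iInter_of_finite fun a => isOpen_iInter_of_finite fun b =>
      isOpen_iInter_of_finite fun _ => isOpen_ne_fun (h2 a) (h2 b)
  · exact isOpen_iInter_of_finite fun a => isOpen_iInter_of_finite fun b =>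
      isOpen_ne_fun (h1 a) (Complex.continuous_conj.comp (h2 b))

/-- Translation of the pole position parallel to the real axis. -/
def shift (p : BasicParam n) (x : ℝ) : BasicParam n :=
  ⟨(p.pole + x, p.proj), by
    have h : p.pole.im ≠ 0 := p.2.1
    simpa using h, p.2.2⟩

theorem pole_shift (p : BasicParam n) (x : ℝ) : (shift p x).pole = p.pole + x := rfl

theorem shift_zero (p : BasicParam n) : shift p 0 = p :=
  Subtype.ext (Prod.ext (by change p.pole + ((0 : ℝ) : ℂ) = p.pole; simp) rfl)

theorem continuous_shift (p : BasicParam n) : Continuous (shift p) :=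
  Continuous.subtype_mk ((continuous_const.add Complex.continuous_ofReal).prodMk
    continuous_const) _

/-- Points moving with different velocities either start together and separate at once, or start
apart and remain so for a short time. -/
theorem eventually_add_mul_ne (c d : ℂ) {x y : ℝ} (h : x ≠ y) :
    ∀ᶠ t : ℝ in 𝓝[≠] 0, c + ((t * x : ℝ) : ℂ) ≠ d + ((t * y : ℝ) : ℂ) := by
  by_cases hcd : c = d
  · filter_upwards [self_mem_nhdsWithin] with t ht heq
    rw [hcd, add_right_inj, Complex.ofReal_inj] at heq
    exact h (mul_left_cancel₀ ht heq)
  · have hc : ∀ e : ℂ, ∀ x : ℝ, Continuous fun t : ℝ => e + ((t * x : ℝ) : ℂ) := fun e x =>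
      continuous_const.add (Complex.continuous_ofReal.comp (continuous_id.mul continuous_const))
    have h0 := (isOpen_ne_fun (hc c x) (hc d y)).mem_nhds (x := 0) (by simpa using hcd)
    exact nhdsWithin_le_nhds h0

theorem dense_genericParams (n k m : ℕ) : Dense (genericParams n k m) := by
  intro q
  -- The pole positions drift parallel to the real axis with the distinct speeds `0, …, k + m - 1`;
  -- the offset `k` separates the lower ones from the upper ones. Conjugation does not change a real
  -- velocity, so coincidences with conjugates are excluded in the same way.
  let F : ℝ → (Fin k → UpperParam n) × (Fin m → LowerParam n) := fun t =>
    (fun a => ⟨shift (q.1 a).1 (t * (a : ℕ)), by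
      rw [pole_shift]; simpa using (q.1 a).2⟩,
     fun b => ⟨shift (q.2 b).1 (t * ((k + b : ℕ) : ℝ)), by
      rw [pole_shift]
      simpa only [Complex.add_im, Complex.ofReal_im, add_zero] using (q.2 b).2⟩)
  have hF : Continuous F := by
    refine Continuous.prodMk (continuous_pi fun a => Continuous.subtype_mk ?_ _)
      (continuous_pi fun b => Continuous.subtype_mk ?_ _)
    · exact (continuous_shift _).comp (continuous_id.mul continuous_const)
    · exact (continuous_shift _).comp (continuous_id.mul continuous_const)
  have hF0 : F 0 = q := by
    refine Prod.ext (funext fun a => Subtype.ext ?_) (funext fun b => Subtype.ext ?_)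
    · change shift (q.1 a).1 (0 * _) = _
      rw [zero_mul, shift_zero]
    · change shift (q.2 b).1 (0 * _) = _
      rw [zero_mul, shift_zero]
  have hlim : Tendsto F (𝓝[≠] 0) (𝓝 q) := by
    have := hF.tendsto 0
    rw [hF0] at this
    exact this.mono_left nhdsWithin_le_nhds
  refine mem_closure_of_tendsto hlim ?_
  have e1 : ∀ᶠ t : ℝ in 𝓝[≠] 0, ∀ a b, a ≠ b → ((F t).1 a).1.pole ≠ ((F t).1 b).1.pole := by
    refine eventually_all.2 fun a => eventually_all.2 fun b => eventually_imp_distrib_left.2 ?_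
    intro hab
    exact eventually_add_mul_ne _ _ (by simpa [Fin.val_inj] using hab)
  have e2 : ∀ᶠ t : ℝ in 𝓝[≠] 0, ∀ a b, a ≠ b → ((F t).2 a).1.pole ≠ ((F t).2 b).1.pole := by
    refine eventually_all.2 fun a => eventually_all.2 fun b => eventually_imp_distrib_left.2 ?_
    intro hab
    exact eventually_add_mul_ne _ _ (by simpa [Fin.val_inj] using hab)
  have e3 : ∀ᶠ t : ℝ in 𝓝[≠] 0, ∀ a b,
      ((F t).1 a).1.pole ≠ starRingEnd ℂ ((F t).2 b).1.pole := by
    refine eventually_all.2 fun a => eventually_all.2 fun b => ?_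
    have hne : ((a : ℕ) : ℝ) ≠ ((k + b : ℕ) : ℝ) := by
      have := a.2
      exact_mod_cast (show (a : ℕ) ≠ k + b by omega)
    filter_upwards [eventually_add_mul_ne (q.1 a).1.pole (starRingEnd ℂ (q.2 b).1.pole) hne]
      with t ht
    change (q.1 a).1.pole + _ ≠ starRingEnd ℂ ((q.2 b).1.pole + _)
    rwa [map_add, Complex.conj_ofReal]
  filter_upwards [e1, e2, e3] with t h1 h2 h3
  exact ⟨h1, h2, h3⟩

theorem upperLoop_mem_simpleLoops {k : ℕ} {x : Fin k → UpperParam n}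
    (h : ∀ a b, a ≠ b → (x a).1.pole ≠ (x b).1.pole) : upperLoop x ∈ simpleLoops n := by
  refine ⟨_, List.pairwise_ofFn.2 fun a b hab => ⟨h a b hab.ne, fun he => ?_⟩, rfl⟩
  have h1 := (x a).2
  have h2 := (x b).2
  rw [he, Complex.conj_im] at h1
  linarith

theorem lowerLoop_mem_simpleLoops {k : ℕ} {y : Fin k → LowerParam n}
    (h : ∀ a b, a ≠ b → (y a).1.pole ≠ (y b).1.pole) : lowerLoop y ∈ simpleLoops n := by
  refine ⟨_, List.pairwise_ofFn.2 fun a b hab => ⟨h a b hab.ne, fun he => ?_⟩, rfl⟩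
  have h1 := (y a).2
  have h2 := (y b).2
  rw [he, Complex.conj_im] at h1
  linarith

theorem noConjPoles_upperLoop_lowerLoop {k m : ℕ} {x : Fin k → UpperParam n}
    {y : Fin m → LowerParam n} (h : ∀ a b, (x a).1.pole ≠ starRingEnd ℂ (y b).1.pole) :
    NoConjPoles (upperLoop x) (lowerLoop y) := by
  intro z hz hz'
  obtain ⟨p, hp, hpz⟩ := exists_pole_eq hz
  obtain ⟨q, hq, hqz⟩ := exists_pole_eq hz'
  obtain ⟨a, rfl⟩ := (List.mem_ofFn' _ _).1 hp
  obtain ⟨b, rfl⟩ := (List.mem_ofFn' _ _).1 hq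
  apply h a b
  rw [hpz, hqz, Complex.conj_conj]

end MeroMatrix

open MeroMatrix in
theorem proposition5p3 (n : ℕ) (hn : 2 ≤ n) :
    -- `M` and `G` consist of the products of basic loops with poles in one half plane
    (∀ φ : MeroMatrix n, φ ∈ loopM n ↔ ∃ k, ∃ x : Fin k → UpperParam n, φ = upperLoop x) ∧
    (∀ φ : MeroMatrix n, φ ∈ loopG n ↔ ∃ k, ∃ y : Fin k → LowerParam n, φ = lowerLoop y) ∧
    -- the `i` operation is well defined
    (∀ φ ∈ loopG n ∪ loopM n, ∃! ψ, IsI φ ψ) ∧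
    -- the actions are well defined away from conjugate poles
    (∀ s ∈ loopM n, ∀ u ∈ loopG n, NoConjPoles s u → ∃! p, IsMinRefactor s u p) ∧
    -- the generic loops form a dense open set, on which everything is defined
    (∀ k m, IsOpen (genericParams n k m) ∧ Dense (genericParams n k m) ∧
      ∀ q ∈ genericParams n k m, upperLoop q.1 ∈ simpleLoops n ∧ lowerLoop q.2 ∈ simpleLoops n ∧
        NoConjPoles (upperLoop q.1) (lowerLoop q.2)) ∧
    -- `(G, J_G)` and `(M, J_M)` are almost groups
    IsAlmostGroupOn (loopG n) (loopJG n) iOp (simpleLoops n) NoCommonPoles ∧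
    IsAlmostGroupOn (loopM n) (loopJM n) iOp (simpleLoops n) NoCommonPoles ∧
    (n = 2 → IsAlmostGroup (loopG n) (loopJG n) iOp ∧ IsAlmostGroup (loopM n) (loopJM n) iOp) ∧
    -- and they form a matched pair
    IsMatchedPairOn (loopG n) (loopJG n) (loopM n) (loopJM n) iOp lAct rAct NoConjPoles := by
  refine ⟨fun φ => mem_loopM_iff_upperLoop hn, fun φ => mem_loopG_iff_lowerLoop hn, ?_,
    fun s hs u hu h => existsUnique_isMinRefactor hn hs hu h,
    fun k m => ⟨isOpen_genericParams n k m, dense_genericParams n k m, fun q hq =>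
      ⟨upperLoop_mem_simpleLoops hq.1, lowerLoop_mem_simpleLoops hq.2.1,
        noConjPoles_upperLoop_lowerLoop hq.2.2⟩⟩, ?_, ?_, ?_, isMatchedPairOn_loops hn⟩
  · rintro φ (hφ | hφ)
    · exact (isGenericLoop_of_mem_loopG hφ).existsUnique_isI hn
    · exact (isGenericLoop_of_mem_loopM hφ).existsUnique_isI hn
  · rw [loopG_eq, loopJG_eq]
    exact isAlmostGroupOn_loopsOn hn isHalfPlane_upper
  · rw [loopM_eq, loopJM_eq]
    exact isAlmostGroupOn_loopsOn hn isHalfPlane_lower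
  · rintro rfl
    rw [loopG_eq, loopJG_eq, loopM_eq, loopJM_eq]
    exact ⟨isAlmostGroup_two isHalfPlane_upper, isAlmostGroup_two isHalfPlane_lower⟩
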